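/- Let $\lambda=(\lambda_1,\dots,\lambda_r)$ be a strict partition, i.e. integers $\lambda_1>\cdots>\lambda_r\ge 0$ ($r\ge 0$), with shifted diagram $SD(\lambda)=\{(i,j)\in\mathbb Z^2: 1\le i\le r,\ i\le j\le \lambda_i+i-1\}$. The same notation $SD(\lambda)$ is used for two-row shapes $(a,b)$ with $a>b\ge0$ or $a=b=0$ (then the diagram is empty). A tableau of shape $\lambda$ over a set $X$ is a map $SD(\lambda)\to X$. Let $\mathbb N'=\{1'<1<2'<2<\cdots\}$, $|k|=|k'|=k$, and let $QSST(\lambda)$ be the set of tableaux $M=(m_{ij})$ of shape $\lambda$ over $\mathbb N'$ whose entries weakly increase along rows and columns, such that for every $k\ge1$ the letter $k'$ occurs at most once in each row and the letter $k$ occurs at most once in each column. For a complex tableau $\boldsymbol s=(s_{ij})$ of shape $\lambda$ put $$\zeta^Q_\lambda(\boldsymbol s)=\sum_{M\in QSST(\lambda)}\ \prod_{(i,j)\in SD(\lambda)}|m_{ij}|^{-s_{ij}},$$ which equals $1$ if the diagram is empty. Let $H(\lambda)=\{(i,j)\in SD(\lambda): j-i=\lambda_k-1\text{ for some }1\le k\le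 r\}$, and let $W^Q_{\lambda,H}$ be the set of complex tableaux $\boldsymbol s$ of shape $\lambda$ with $\Re(s_{ij})\ge1$ for $(i,j)\in SD(\lambda)\setminus H(\lambda)$ and $\Re(s_{ij})>1$ for $(i,j)\in H(\lambda)$. Let $\ell=r$ if $r$ is even; if $r$ is odd let $\ell=r+1$ and $\lambda_{r+1}=0$. Let $M_\lambda(\boldsymbol s)=(a_{ij})$ be the $\ell\times \ell$ strictly upper triangular matrix with $$a_{ij}=\zeta^Q_{(\lambda_i,\lambda_j)}(\boldsymbol s_{(\lambda_i,\lambda_j)})\qquad(1\le i<j\le \ell),$$ where $\boldsymbol s_{(\lambda_i,\lambda_j)}$ is the tableau of shape $(\lambda_i,\lambda_j)$ with first row $s_{ii},s_{i,i+1},\dots,s_{i,i+\lambda_i-1}$ and second row $s_{jj},s_{j,j+1},\dots,s_{j,j+\lambda_j-1}$. For an upper triangular matrix $A=(a_{ij})$ of size $2n$ let $$\operatorname{pf}(A)=\sum_{\pi}\operatorname{sgn}(\pi)\prod_{i=1}^n a_{\pi(2i-1),\pi(2i)},$$ where $\pi$ runs over the permutations of $\{1,\dots,2n\}$ with $\pi(1)<\pi(3)<\cdots<\pi(2n-1)$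 and $\pi(2i-1)<\pi(2i)$ for $1\le i\le n$. Let $G_\lambda$ be the finite group of all permutations $\sigma$ of $SD(\lambda)$ that map each diagonal $I(d)=\{(k,l)\in SD(\lambda): l-k=d\}$ to itself, acting on tableaux by permuting the entries, $\boldsymbol s^\sigma=\boldsymbol s\circ\sigma$. Then for every strict partition $\lambda$ and every $\boldsymbol s\in W^Q_{\lambda,H}$, the series that define $\zeta^Q_\lambda(\boldsymbol s^\sigma)$ and all entries $a_{ij}$, $i<j$, of $M_\lambda(\boldsymbol s^\sigma)$ converge absolutely for all $\sigma\in G_\lambda$, and $$\sum_{\sigma\in G_\lambda}\zeta^Q_\lambda(\boldsymbol s^\sigma)=\sum_{\sigma\in G_\lambda}\operatorname{pf}\bigl(M_\lambda(\boldsymbol s^\sigma)\bigr).$$ -/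

import Mathlib

open scoped BigOperators

namespace SchurQZeta

/-- The shifted diagram of a sequence of row lengths `lam`, with rows and columns numbered
from `0`: row `i` consists of the `lam i` boxes `(i, i), (i, i + 1), …, (i, i + lam i - 1)`. -/
def shiftedDiagram {r : ℕ} (lam : Fin r → ℕ) : Finset (ℕ × ℕ) :=
  Finset.univ.biUnion fun i : Fin r =>
    (Finset.Ico (i : ℕ) (i + lam i)).image fun j => ((i : ℕ), j)

theorem mem_shiftedDiagram {r : ℕ} (lam : Fin r → ℕ) (b : ℕ × ℕ) :
    b ∈ shiftedDiagram lam ↔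
      ∃ i : Fin r, b.1 = (i : ℕ) ∧ (i : ℕ) ≤ b.2 ∧ b.2 < (i : ℕ) + lam i := by
  rcases b with ⟨x, y⟩
  simp only [shiftedDiagram, Finset.mem_biUnion, Finset.mem_univ, true_and, Finset.mem_image,
    Finset.mem_Ico, Prod.mk.injEq]
  constructor
  · rintro ⟨i, j, ⟨h1, h2⟩, rfl, rfl⟩
    exact ⟨i, rfl, h1, h2⟩
  · rintro ⟨i, h, h1, h2⟩
    exact ⟨i, y, ⟨h1, h2⟩, h.symm, rfl⟩

/-- A box of the shifted diagram. -/
abbrev Box {r : ℕ} (lam : Fin r → ℕ) : Type := {b : ℕ × ℕ // b ∈ shiftedDiagram lam}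

/-- Shifted tableaux of shape `lam` over `X`: arbitrary fillings of the diagram. -/
abbrev ShiftedTableau {r : ℕ} (lam : Fin r → ℕ) (X : Type*) : Type _ := Box lam → X

/-- The content (column minus row) of a box: the index of its diagonal. -/
def content {r : ℕ} {lam : Fin r → ℕ} (b : Box lam) : ℤ := (b.1.2 : ℤ) - (b.1.1 : ℤ)

/-- The alphabet `1' < 1 < 2' < 2 < ⋯`, ordered lexicographically:
`(n, false)` is the letter `n'` and `(n, true)` is the letter `n`. -/
abbrev MarkedLetter : Type := ℕ+ ×ₗ Bool

/-- `|n'| = |n| = n`. -/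
def MarkedLetter.abs (m : MarkedLetter) : ℕ+ := (ofLex m).1

/-- The letter is one of `1', 2', …`. -/
def MarkedLetter.IsMarked (m : MarkedLetter) : Prop := (ofLex m).2 = false

/-- Semi-standard marked shifted tableaux without condition on the main diagonal. -/
structure IsQSST {r : ℕ} {lam : Fin r → ℕ} (M : ShiftedTableau lam MarkedLetter) : Prop where
  row_weak : ∀ b c : Box lam, b.1.1 = c.1.1 → b.1.2 ≤ c.1.2 → M b ≤ M c
  col_weak : ∀ b c : Box lam, b.1.2 = c.1.2 → b.1.1 ≤ c.1.1 → M b ≤ M c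
  /-- each marked letter occurs at most once in every row -/
  row_marked : ∀ b c : Box lam, b.1.1 = c.1.1 → M b = M c → (M b).IsMarked → b = c
  /-- each unmarked letter occurs at most once in every column -/
  col_unmarked : ∀ b c : Box lam, b.1.2 = c.1.2 → M b = M c → ¬ (M b).IsMarked → b = c

/-- The set `QSST(lam)`. -/
def QSST {r : ℕ} (lam : Fin r → ℕ) : Set (ShiftedTableau lam MarkedLetter) := {M | IsQSST M}

/-- The summand `1 / M ^ s`, where `M ^ s` is the product of all `|m_b| ^ (s_b)`. -/
noncomputable def zetaQTerm {r : ℕ} {lam : Fin r → ℕ} (s : ShiftedTableau lam ℂ)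
    (M : ShiftedTableau lam MarkedLetter) : ℂ :=
  1 / ∏ b : Box lam, (((M b).abs : ℕ) : ℂ) ^ s b

/-- Absolute convergence of the series that defines the Schur `Q`-multiple zeta function. -/
def ZetaQSummable {r : ℕ} (lam : Fin r → ℕ) (s : ShiftedTableau lam ℂ) : Prop :=
  Summable fun M : QSST lam => zetaQTerm s M.1

/-- The Schur `Q`-multiple zeta function of shape `lam`. -/
noncomputable def zetaQ {r : ℕ} (lam : Fin r → ℕ) (s : ShiftedTableau lam ℂ) : ℂ :=
  ∑' M : QSST lam, zetaQTerm s M.1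

/-- The boxes on the diagonals that contain the last box of some row
(the last box of row `k` has content `lam k - 1`). -/
def rowEndDiagonals {r : ℕ} (lam : Fin r → ℕ) : Set (Box lam) :=
  {b | ∃ k : Fin r, content b = (lam k : ℤ) - 1}

/-- The region of variables in which the identity is stated. -/
def regionWQH {r : ℕ} (lam : Fin r → ℕ) : Set (ShiftedTableau lam ℂ) :=
  {s | (∀ b, b ∉ rowEndDiagonals lam → 1 ≤ (s b).re) ∧
    (∀ b, b ∈ rowEndDiagonals lam → 1 < (s b).re)}

/-- The permutations of the boxes that map every diagonal to itself, i.e. the products over all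
diagonals of permutations of the boxes of that diagonal. -/
def diagPerms {r : ℕ} (lam : Fin r → ℕ) : Finset (Equiv.Perm (Box lam)) :=
  Finset.univ.filter fun σ => ∀ b, content (σ b) = content b

/-- The set of permutations that parametrizes the 1-factors of `{1, …, 2n}` (here numbered from
`0`): `π(1) < π(3) < ⋯ < π(2n-1)` and `π(2i-1) < π(2i)` for all `i`. -/
def oneFactors (n : ℕ) : Finset (Equiv.Perm (Fin (2 * n))) :=
  Finset.univ.filter fun π =>
    (∀ i j : Fin n, i < j → π ⟨2 * i, by omega⟩ < π ⟨2 * j, by omega⟩) ∧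
      ∀ i : Fin n, π ⟨2 * i, by omega⟩ < π ⟨2 * i + 1, by omega⟩

/-- The pfaffian of an upper triangular (or antisymmetric) matrix of even size. -/
def pfaffian {n : ℕ} (A : Matrix (Fin (2 * n)) (Fin (2 * n)) ℂ) : ℂ :=
  ∑ π ∈ oneFactors n, ((Equiv.Perm.sign π : ℤ) : ℂ) *
    ∏ i : Fin n, A (π ⟨2 * i, by omega⟩) (π ⟨2 * i + 1, by omega⟩)

/-- The parts of `lam`, continued by zeros. -/
def part {r : ℕ} (lam : Fin r → ℕ) (k : ℕ) : ℕ := if h : k < r then lam ⟨k, h⟩ else 0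

theorem mem_shiftedDiagram_of_lt_part {r : ℕ} (lam : Fin r → ℕ) {k l : ℕ}
    (h : l < part lam k) : (k, k + l) ∈ shiftedDiagram lam := by
  rw [mem_shiftedDiagram]
  unfold part at h
  split_ifs at h with hk
  · exact ⟨⟨k, hk⟩, rfl, by simp, by simpa using h⟩
  · omega

theorem lt_of_fst_eq_zero {a c : ℕ} (b : Box ![a, c]) (h : b.1.1 = 0) : b.1.2 < a := by
  obtain ⟨i, h1, h2, h3⟩ := (mem_shiftedDiagram _ _).1 b.2
  have hi : i = 0 := Fin.ext (by simpa [h] using h1.symm)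
  subst hi
  simpa using h3

theorem lt_of_fst_ne_zero {a c : ℕ} (b : Box ![a, c]) (h : b.1.1 ≠ 0) : b.1.2 - 1 < c := by
  obtain ⟨i, h1, h2, h3⟩ := (mem_shiftedDiagram _ _).1 b.2
  have hi : i = 1 := by
    have : (i : ℕ) ≠ 0 := h1 ▸ h
    exact Fin.ext (by have := i.2; simp; omega)
  subst hi
  simp at h2 h3
  omega

/-- The tableau of the two-row shape `(lam_i, lam_j)` whose first row is the `i`-th row of `s` and
whose second row is the `j`-th row of `s`. -/
def twoRows {r : ℕ} (lam : Fin r → ℕ) (s : ShiftedTableau lam ℂ) (i j : ℕ) :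
    ShiftedTableau ![part lam i, part lam j] ℂ := fun b =>
  if h : b.1.1 = 0 then
    s ⟨(i, i + b.1.2), mem_shiftedDiagram_of_lt_part lam (lt_of_fst_eq_zero b h)⟩
  else
    s ⟨(j, j + (b.1.2 - 1)), mem_shiftedDiagram_of_lt_part lam (lt_of_fst_ne_zero b h)⟩

/-- The upper triangular matrix of two-row `Q`-zeta functions. Its size is `r` for even `r`; for
odd `r` one more part `0` is appended to `lam`, and the size is `r + 1`. -/
noncomputable def pfMatrix {r : ℕ} (lam : Fin r → ℕ) (s : ShiftedTableau lam ℂ) :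
    Matrix (Fin (2 * ((r + 1) / 2))) (Fin (2 * ((r + 1) / 2))) ℂ :=
  Matrix.of fun i j =>
    if i < j then zetaQ ![part lam i, part lam j] (twoRows lam s i j) else 0

end SchurQZeta

namespace SchurQZeta

/-! The identity is the limit of an identity for letters of absolute value at most `N`, where all
sums are finite and the weights are arbitrary.

If the weight of a letter depends only on the letter and on the diagonal of its box, no
symmetrization is needed: the sum over tableaux is the Pfaffian of the two-row sums
(`sum_boundedQSST_eq_pf`). Give a filling that satisfies only the row conditions the sign of the
sequence of absolute values of its row starts. Exchanging initial segments of two adjacent rows at a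
maximal violation of the column condition moves letters along diagonals and reverses the sign, so
exactly the tableaux survive, with sign one (`sum_boundedQSST_eq_sum_boundedRowFillings`). In the
signed sum the rows are coupled only through the sign of their starts. That sign is itself the
Pfaffian of the pairwise order signs (`pf_ordSign_comp`), so the sum is a Pfaffian by minor
summation (`pf_gram`), and the case of two rows identifies its entries.

For weights `y b a` that depend on the box, the diagonal `d` gets the weight `∑ X_b y(b, a)` over
its boxes `b`. The coefficient of the product of all `X_b` turns both sides into sums over
`diagPerms` (`sum_diagPerms_boundedQSST`). On the Pfaffian side this works because each 1-factor
distributes the rows of `lam` over two-row shapes.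

The passage to the limit needs absolute convergence: the last letter of a row is its largest, so the
exponent surplus there pays for the whole row (`summable_prod_rpow`). -/

/-! ### Pfaffians as sums over the full symmetric group. -/

/-- The positions `2 i` and `2 i + 1`, as pairs of a block and a position in the block. -/
def blockEquiv (n : ℕ) : Fin n × Bool ≃ Fin (2 * n) where
  toFun x := ⟨2 * x.1 + x.2.toNat, by have := x.1.2; have := Bool.toNat_le x.2; omega⟩
  invFun y := (⟨y / 2, by have := y.2; omega⟩, decide ((y : ℕ) % 2 = 1))
  left_inv := by
    rintro ⟨i, _ | _⟩
    · simp
    · simp; ext; simp; omega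
  right_inv := by
    intro y
    ext
    by_cases h : (y : ℕ) % 2 = 1 <;> simp [h] <;> omega

theorem blockEquiv_lt {n : ℕ} {i j : Fin n} (h : i < j) (b c : Bool) :
    blockEquiv n (i, b) < blockEquiv n (j, c) := by
  have h' : (i : ℕ) < j := h
  have hb := Bool.toNat_le b
  change 2 * (i : ℕ) + b.toNat < 2 * (j : ℕ) + c.toNat
  omega

theorem mem_oneFactors {n : ℕ} (π : Equiv.Perm (Fin (2 * n))) :
    π ∈ oneFactors n ↔ StrictMono (fun i => π (blockEquiv n (i, false))) ∧
      ∀ i, π (blockEquiv n (i, false)) < π (blockEquiv n (i, true)) := by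
  simp only [oneFactors, Finset.mem_filter, Finset.mem_univ, true_and]
  rfl

/-- The Pfaffian of an upper triangular matrix over a commutative ring. -/
def pf {R : Type*} [CommRing R] {n : ℕ} (A : Fin (2 * n) → Fin (2 * n) → R) : R :=
  ∑ π ∈ oneFactors n, ((Equiv.Perm.sign π : ℤ) : R) *
    ∏ i : Fin n, A (π (blockEquiv n (i, false))) (π (blockEquiv n (i, true)))

theorem pfaffian_eq_pf {n : ℕ} (A : Matrix (Fin (2 * n)) (Fin (2 * n)) ℂ) :
    pfaffian A = pf A := rfl

theorem pf_congr {R : Type*} [CommRing R] {n : ℕ} {A B : Fin (2 * n) → Fin (2 * n) → R}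
    (h : ∀ i j, i < j → A i j = B i j) : pf A = pf B := by
  refine Finset.sum_congr rfl fun π hπ => ?_
  congr 1
  exact Finset.prod_congr rfl fun i _ => h _ _ (((mem_oneFactors π).1 hπ).2 i)

/-- The permutation of the blocks by `g` combined with the flips of the blocks `i` with `c i`. -/
def blockPerm {n : ℕ} (g : Equiv.Perm (Fin n)) (c : Fin n → Bool) :
    Equiv.Perm (Fin n × Bool) where
  toFun x := (g x.1, xor x.2 (c x.1))
  invFun x := (g.symm x.1, xor x.2 (c (g.symm x.1)))
  left_inv x := by ext <;> simp
  right_inv x := by ext <;> simp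

/-- The permutation `g` acts on both copies of `Fin n`, so its sign enters squared; only the flips
count. -/
theorem sign_blockPerm {n : ℕ} (g : Equiv.Perm (Fin n)) (c : Fin n → Bool) :
    (Equiv.Perm.sign (blockPerm g c) : ℤ) = ∏ i, if c i then -1 else 1 := by
  have h : blockPerm g c = (Equiv.prodCongrLeft fun _ : Bool => g) *
      (Equiv.prodCongrRight fun i => if c i then Equiv.swap false true else 1) := by
    ext ⟨i, b⟩
    · simp [blockPerm, Equiv.prodCongrLeft, Equiv.prodCongrRight]
    · cases hc : c i <;> cases b <;>
        simp [blockPerm, Equiv.prodCongrLeft, Equiv.prodCongrRight, hc]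
  rw [h, Equiv.Perm.sign_mul, Equiv.Perm.sign_prodCongrLeft, Equiv.Perm.sign_prodCongrRight]
  simp only [Fintype.prod_bool, Int.units_mul_self, one_mul, Units.coe_prod]
  refine Finset.prod_congr rfl fun i _ => ?_
  cases c i <;> simp

/-- The same permutation on `Fin (2 * n)`. -/
def blockPerm' {n : ℕ} (x : Equiv.Perm (Fin n) × (Fin n → Bool)) :
    Equiv.Perm (Fin (2 * n)) := (blockEquiv n).permCongr (blockPerm x.1 x.2)

theorem blockPerm'_apply {n : ℕ} (x : Equiv.Perm (Fin n) × (Fin n → Bool)) (i : Fin n)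
    (b : Bool) :
    blockPerm' x (blockEquiv n (i, b)) = blockEquiv n (x.1 i, xor b (x.2 i)) := by
  simp [blockPerm', blockPerm]

theorem blockPerm'_inv_apply {n : ℕ} (x : Equiv.Perm (Fin n) × (Fin n → Bool)) (i : Fin n)
    (b : Bool) :
    (blockPerm' x)⁻¹ (blockEquiv n (i, b)) =
      blockEquiv n (x.1.symm i, xor b (x.2 (x.1.symm i))) := by
  rw [Equiv.Perm.inv_eq_iff_eq, blockPerm'_apply]
  simp

/-- Every permutation of `Fin (2 * n)` is uniquely a 1-factor times a block permutation. -/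
theorem bijective_oneFactors_mul_blockPerm (n : ℕ) :
    Function.Bijective fun x : oneFactors n × (Equiv.Perm (Fin n) × (Fin n → Bool)) =>
      x.1.1 * blockPerm' x.2 := by
  constructor
  · rintro ⟨⟨τ, hτ⟩, g, c⟩ ⟨⟨τ', hτ'⟩, g', c'⟩ h
    rw [mem_oneFactors] at hτ hτ'
    have hE : ∀ i b, τ (blockEquiv n (g i, xor b (c i))) =
        τ' (blockEquiv n (g' i, xor b (c' i))) := by
      intro i b
      have := congrArg (fun p : Equiv.Perm (Fin (2 * n)) => p (blockEquiv n (i, b))) h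
      simpa [Equiv.Perm.mul_apply, blockPerm'_apply] using this
    have hc : c = c' := by
      funext i
      have h0 := hE i false
      have h1 := hE i true
      have h2 := hτ.2 (g i)
      have h3 := hτ'.2 (g' i)
      cases hci : c i <;> cases hci' : c' i <;> simp only [hci, hci'] at h0 h1 ⊢ <;>
        simp only [Bool.xor_false, Bool.xor_true, Bool.not_true, Bool.not_false] at h0 h1 <;>
        · rw [h0, h1] at h2
          exact absurd h2 h3.asymm
    subst hc
    have hE' : ∀ i b, τ (blockEquiv n (g i, b)) = τ' (blockEquiv n (g' i, b)) := by
      intro i b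
      simpa using hE i (xor b (c i))
    -- Two strictly increasing enumerations of the same set coincide.
    have hr : (fun i => τ (blockEquiv n (i, false))) = fun i => τ' (blockEquiv n (i, false)) := by
      rw [← StrictMono.range_inj hτ.1 hτ'.1]
      ext y
      constructor
      · rintro ⟨i, rfl⟩
        exact ⟨g' (g.symm i), by simpa using (hE' (g.symm i) false).symm⟩
      · rintro ⟨i, rfl⟩
        exact ⟨g (g'.symm i), by simpa using hE' (g'.symm i) false⟩
    have hg : g = g' := by
      ext1 i
      have h1 := hE' i false
      rw [← congrFun hr (g' i)] at h1
      have := (blockEquiv n).injective (τ.injective h1)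
      exact (Prod.ext_iff.1 this).1
    subst hg
    have : τ = τ' := by
      ext1 y
      obtain ⟨⟨i, b⟩, rfl⟩ := (blockEquiv n).surjective y
      simpa using hE' (g.symm i) b
    subst this
    rfl
  · intro π
    -- `c` marks the blocks on which `π` decreases, and `o` is the smaller image of a block. Undoing
    -- the flips and sorting by `o` leaves a 1-factor.
    set c : Fin n → Bool := fun i =>
      decide (π (blockEquiv n (i, true)) < π (blockEquiv n (i, false))) with hc
    set o : Fin n → Fin (2 * n) := fun i => π (blockEquiv n (i, c i)) with ho
    have hinj : Function.Injective o := fun i j h =>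
      (Prod.ext_iff.1 ((blockEquiv n).injective (π.injective h))).1
    set g := Tuple.sort o with hg
    have hmono : StrictMono (o ∘ g) :=
      (Tuple.monotone_sort o).strictMono_of_injective (hinj.comp g.injective)
    refine ⟨⟨⟨π * (blockPerm' (g.symm, c))⁻¹, ?_⟩, g.symm, c⟩, by simp⟩
    rw [mem_oneFactors]
    simp only [Equiv.Perm.mul_apply, blockPerm'_inv_apply, Bool.false_xor, Bool.true_xor,
      Equiv.symm_symm]
    refine ⟨hmono, fun i => ?_⟩
    have hne : π (blockEquiv n (g i, true)) ≠ π (blockEquiv n (g i, false)) := by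
      intro h
      simpa using (blockEquiv n).injective (π.injective h)
    by_cases h : π (blockEquiv n (g i, true)) < π (blockEquiv n (g i, false))
    · have : c (g i) = true := by simpa [hc] using h
      simpa [this] using h
    · have : c (g i) = false := by simpa [hc] using h
      simp only [this, Bool.not_false]
      exact lt_of_le_of_ne (not_lt.1 h) hne.symm

theorem sum_perm_eq_card_mul_sum_oneFactors {n : ℕ} (f : Equiv.Perm (Fin (2 * n)) → ℤ)
    (hf : ∀ π x, f (π * blockPerm' x) = f π) :
    ∑ π, f π = Fintype.card (Equiv.Perm (Fin n) × (Fin n → Bool)) * ∑ π ∈ oneFactors n, f π := by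
  rw [← (bijective_oneFactors_mul_blockPerm n).sum_comp f, Fintype.sum_prod_type]
  simp only [hf, Finset.sum_const, Finset.card_univ, nsmul_eq_mul]
  rw [← Finset.mul_sum, Finset.sum_coe_sort (oneFactors n) f]

/-- The summand of the Pfaffian of an antisymmetric matrix. -/
def pfTerm {n : ℕ} (A : Fin (2 * n) → Fin (2 * n) → ℤ) (π : Equiv.Perm (Fin (2 * n))) : ℤ :=
  (Equiv.Perm.sign π : ℤ) *
    ∏ i : Fin n, A (π (blockEquiv n (i, false))) (π (blockEquiv n (i, true)))

theorem pfTerm_mul_blockPerm {n : ℕ} {A : Fin (2 * n) → Fin (2 * n) → ℤ}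
    (hA : ∀ i j, A i j = -A j i) (π : Equiv.Perm (Fin (2 * n)))
    (x : Equiv.Perm (Fin n) × (Fin n → Bool)) :
    pfTerm A (π * blockPerm' x) = pfTerm A π := by
  obtain ⟨g, c⟩ := x
  have h1 : (Equiv.Perm.sign (blockPerm' (g, c)) : ℤ) = ∏ i, if c i then -1 else 1 := by
    rw [← sign_blockPerm g c, blockPerm', Equiv.Perm.sign_permCongr]
  unfold pfTerm
  simp only [Equiv.Perm.sign_mul, Units.val_mul, h1, Equiv.Perm.mul_apply, blockPerm'_apply]
  rw [mul_assoc, ← Finset.prod_mul_distrib]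
  congr 1
  rw [← Equiv.prod_comp g
    (fun i => A (π (blockEquiv n (i, false))) (π (blockEquiv n (i, true))))]
  refine Finset.prod_congr rfl fun i _ => ?_
  cases c i
  · simp
  · rw [hA (π (blockEquiv n (g i, false)))]
    simp

/-- For antisymmetric `A` the 1-factors are just coset representatives modulo block permutations.
Over `ℤ` the order of that group can be cancelled; `pf_gram` then casts the result to any
commutative ring. -/
theorem pf_eq_sum_perm {n : ℕ} {A : Fin (2 * n) → Fin (2 * n) → ℤ}
    (hA : ∀ i j, A i j = -A j i) :
    ∑ π, pfTerm A π = Fintype.card (Equiv.Perm (Fin n) × (Fin n → Bool)) * pf A :=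
  sum_perm_eq_card_mul_sum_oneFactors _ (pfTerm_mul_blockPerm hA)

theorem pf_comp_perm {n : ℕ} {A : Fin (2 * n) → Fin (2 * n) → ℤ}
    (hA : ∀ i j, A i j = -A j i) (σ : Equiv.Perm (Fin (2 * n))) :
    pf (fun i j => A (σ i) (σ j)) = (Equiv.Perm.sign σ : ℤ) * pf A := by
  have hne : (Fintype.card (Equiv.Perm (Fin n) × (Fin n → Bool)) : ℤ) ≠ 0 := by
    exact_mod_cast Fintype.card_ne_zero
  apply mul_left_cancel₀ hne
  rw [← pf_eq_sum_perm (A := fun i j => A (σ i) (σ j)) (fun i j => hA _ _), mul_left_comm,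
    ← pf_eq_sum_perm hA, ← Equiv.sum_comp (Equiv.mulLeft σ) (pfTerm A), Finset.mul_sum]
  refine Finset.sum_congr rfl fun π _ => ?_
  simp only [pfTerm, Equiv.coe_mulLeft, Equiv.Perm.sign_mul, Units.val_mul, Equiv.Perm.mul_apply]
  rw [← mul_assoc, ← mul_assoc, ← Units.val_mul, Int.units_mul_self, Units.val_one, one_mul]

/-! ### Order signs and their Pfaffian. -/

/-- The sign of `b - a`. -/
def ordSign {α : Type*} [LinearOrder α] (a b : α) : ℤ :=
  if a < b then 1 else if b < a then -1 else 0

theorem ordSign_antisymm {α : Type*} [LinearOrder α] (a b : α) :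
    ordSign a b = -ordSign b a := by
  rcases lt_trichotomy a b with h | h | h
  · simp [ordSign, h, h.asymm]
  · simp [ordSign, h]
  · simp [ordSign, h, h.asymm]

theorem ordSign_of_lt {α : Type*} [LinearOrder α] {a b : α} (h : a < b) : ordSign a b = 1 := by
  simp [ordSign, h]

theorem ordSign_self {α : Type*} [LinearOrder α] (a : α) : ordSign a a = 0 := by
  simp [ordSign]

theorem ordSign_comp_strictMono {α β : Type*} [LinearOrder α] [LinearOrder β] {f : α → β}
    (hf : StrictMono f) (a b : α) : ordSign (f a) (f b) = ordSign a b := by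
  simp [ordSign, hf.lt_iff_lt]

/-- The sign of the sequence `k`: the sign of the sorting permutation, or zero if `k` is not
injective. -/
def seqSign {α : Type*} [LinearOrder α] {m : ℕ} (k : Fin m → α) : ℤ :=
  ∏ j, ∏ i ∈ Finset.Iio j, ordSign (k i) (k j)

theorem seqSign_comp_perm {α : Type*} [LinearOrder α] {m : ℕ} (k : Fin m → α)
    (σ : Equiv.Perm (Fin m)) : seqSign (k ∘ σ) = (Equiv.Perm.sign σ : ℤ) * seqSign k := by
  have := σ.prod_Iio_comp_eq_sign_mul_prod (f := fun i j => ordSign (k i) (k j))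
    (fun i j => ordSign_antisymm _ _)
  simpa [seqSign] using this

theorem seqSign_eq_zero {α : Type*} [LinearOrder α] {m : ℕ} {k : Fin m → α} {i j : Fin m}
    (hij : i ≠ j) (h : k i = k j) : seqSign k = 0 := by
  wlog hlt : i < j generalizing i j
  · exact this hij.symm h.symm (lt_of_le_of_ne (not_lt.1 hlt) hij.symm)
  refine Finset.prod_eq_zero (Finset.mem_univ j) ?_
  refine Finset.prod_eq_zero (Finset.mem_Iio.2 hlt) ?_
  rw [h, ordSign_self]

theorem seqSign_of_strictMono {α : Type*} [LinearOrder α] {m : ℕ} {k : Fin m → α}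
    (h : StrictMono k) : seqSign k = 1 :=
  Finset.prod_eq_one fun _ _ => Finset.prod_eq_one fun _ hi =>
    ordSign_of_lt (h (Finset.mem_Iio.1 hi))

/-- The block that contains the position `y`. -/
def block {n : ℕ} (y : Fin (2 * n)) : Fin n := ((blockEquiv n).symm y).1

@[simp] theorem block_blockEquiv {n : ℕ} (i : Fin n) (b : Bool) :
    block (blockEquiv n (i, b)) = i := by simp [block]

theorem eq_blockEquiv_block {n : ℕ} (y : Fin (2 * n)) : ∃ b, y = blockEquiv n (block y, b) :=
  ⟨((blockEquiv n).symm y).2, by simp [block]⟩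

theorem ordSign_eq_ordSign_block {n : ℕ} {x y : Fin (2 * n)} (h : block x ≠ block y) :
    ordSign x y = ordSign (block x) (block y) := by
  obtain ⟨b, hb⟩ := eq_blockEquiv_block x
  obtain ⟨c, hc⟩ := eq_blockEquiv_block y
  rcases lt_or_gt_of_ne h with h | h
  · rw [ordSign_of_lt h, ordSign_of_lt]
    rw [hb, hc]
    exact blockEquiv_lt h b c
  · rw [ordSign_antisymm, ordSign_antisymm (block x), ordSign_of_lt h, ordSign_of_lt]
    rw [hb, hc]
    exact blockEquiv_lt h c b

/-- The blocks that are not images of blocks under `π`. -/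
def splitBlocks {n : ℕ} (π : Equiv.Perm (Fin (2 * n))) : Finset (Fin n) :=
  Finset.univ.filter fun t =>
    block (π⁻¹ (blockEquiv n (t, false))) ≠ block (π⁻¹ (blockEquiv n (t, true)))

/-- The transposition of the two positions of the block `t`. -/
def blockFlip {n : ℕ} (t : Fin n) : Equiv.Perm (Fin (2 * n)) :=
  Equiv.swap (blockEquiv n (t, false)) (blockEquiv n (t, true))

theorem blockFlip_of_ne {n : ℕ} {t i : Fin n} (h : i ≠ t) (b : Bool) :
    blockFlip t (blockEquiv n (i, b)) = blockEquiv n (i, b) :=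
  Equiv.swap_apply_of_ne_of_ne (by simp [h]) (by simp [h])

theorem blockFlip_self {n : ℕ} (t : Fin n) (b : Bool) :
    blockFlip t (blockEquiv n (t, b)) = blockEquiv n (t, !b) := by
  cases b <;> simp [blockFlip]

theorem block_blockFlip {n : ℕ} (t : Fin n) (y : Fin (2 * n)) :
    block (blockFlip t y) = block y := by
  obtain ⟨b, hb⟩ := eq_blockEquiv_block y
  by_cases h : block y = t
  · rw [hb, h, blockFlip_self]; simp
  · rw [hb, blockFlip_of_ne h]

theorem splitBlocks_blockFlip_mul {n : ℕ} (t : Fin n) (π : Equiv.Perm (Fin (2 * n))) :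
    splitBlocks (blockFlip t * π) = splitBlocks π := by
  ext i
  have hinv : (blockFlip t)⁻¹ = blockFlip t := Equiv.swap_inv _ _
  simp only [splitBlocks, Finset.mem_filter, Finset.mem_univ, true_and, mul_inv_rev,
    Equiv.Perm.mul_apply, hinv]
  by_cases h : i = t
  · subst h
    rw [blockFlip_self, blockFlip_self]
    exact ne_comm
  · rw [blockFlip_of_ne h, blockFlip_of_ne h]

theorem splitBlocks_mul_blockPerm {n : ℕ} (π : Equiv.Perm (Fin (2 * n)))
    (x : Equiv.Perm (Fin n) × (Fin n → Bool)) :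
    splitBlocks (π * blockPerm' x) = splitBlocks π := by
  have h : ∀ y : Fin (2 * n), block ((blockPerm' x)⁻¹ y) = x.1.symm (block y) := by
    intro y
    obtain ⟨b, hb⟩ := eq_blockEquiv_block y
    conv_lhs => rw [hb, blockPerm'_inv_apply]
    simp
  ext i
  simp only [splitBlocks, Finset.mem_filter, Finset.mem_univ, true_and, mul_inv_rev,
    Equiv.Perm.mul_apply, h, ne_eq, EmbeddingLike.apply_eq_iff_eq]

/-- Only the sign of the permutation changes. A factor whose two positions lie in one block does not
involve `t`, because `t` is split; any other factor depends only on the blocks. -/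
theorem pfTerm_blockFlip_mul {n : ℕ} {t : Fin n} {π : Equiv.Perm (Fin (2 * n))}
    (ht : t ∈ splitBlocks π) :
    pfTerm ordSign (blockFlip t * π) = -pfTerm ordSign π := by
  have hs : Equiv.Perm.sign (blockFlip t) = -1 := Equiv.Perm.sign_swap (by simp)
  unfold pfTerm
  rw [Equiv.Perm.sign_mul, hs, neg_one_mul, Units.val_neg, neg_mul]
  congr 2
  refine Finset.prod_congr rfl fun i _ => ?_
  simp only [Equiv.Perm.mul_apply]
  set x := π (blockEquiv n (i, false)) with hx
  set y := π (blockEquiv n (i, true)) with hy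
  have hxy : x ≠ y := fun h => by simpa using (blockEquiv n).injective (π.injective h)
  by_cases h : block x = block y
  · obtain ⟨b, hb⟩ := eq_blockEquiv_block x
    obtain ⟨c, hc⟩ := eq_blockEquiv_block y
    by_cases h' : block x = t
    · exfalso
      have h1 : block (π⁻¹ x) = block (π⁻¹ y) := by simp [hx, hy]
      rw [← h, h'] at hc
      rw [h'] at hb
      simp only [splitBlocks, Finset.mem_filter, Finset.mem_univ, true_and] at ht
      cases b <;> cases c
      · exact hxy (hb.trans hc.symm)
      · rw [hb, hc] at h1; exact ht h1
      · rw [hb, hc] at h1; exact ht h1.symm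
      · exact hxy (hb.trans hc.symm)
    · have h2 : blockFlip t x = x := by
        conv_lhs => rw [hb]
        rw [blockFlip_of_ne h', ← hb]
      have h3 : blockFlip t y = y := by
        conv_lhs => rw [hc]
        rw [blockFlip_of_ne (h ▸ h'), ← hc]
      rw [h2, h3]
  · rw [ordSign_eq_ordSign_block h, ordSign_eq_ordSign_block, block_blockFlip, block_blockFlip]
    rwa [block_blockFlip, block_blockFlip]

/-- Flipping the least split block is a sign-reversing involution, since flips preserve the set of
split blocks. -/
theorem sum_pfTerm_split_eq_zero (n : ℕ) :
    ∑ π : Equiv.Perm (Fin (2 * n)) with (splitBlocks π).Nonempty, pfTerm ordSign π = 0 := by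
  have hmem : ∀ (π : Equiv.Perm (Fin (2 * n))) (h : (splitBlocks π).Nonempty),
      (splitBlocks π).min' h ∈ splitBlocks π := fun π h => Finset.min'_mem _ _
  refine Finset.sum_involution
    (fun π hπ => blockFlip ((splitBlocks π).min' (Finset.mem_filter.1 hπ).2) * π)
    (fun π hπ => ?_) (fun π hπ _ h => ?_) (fun π hπ => ?_) (fun π hπ => ?_)
  · rw [pfTerm_blockFlip_mul (hmem π (Finset.mem_filter.1 hπ).2), add_neg_cancel]
  · have h1 := mul_eq_right.1 h
    have h2 := blockFlip_self ((splitBlocks π).min' (Finset.mem_filter.1 hπ).2) false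
    rw [h1] at h2
    simpa using (blockEquiv n).injective h2
  · rw [Finset.mem_filter, splitBlocks_blockFlip_mul]
    exact ⟨Finset.mem_univ _, (Finset.mem_filter.1 hπ).2⟩
  · simp only [splitBlocks_blockFlip_mul]
    rw [← mul_assoc, blockFlip, Equiv.swap_mul_self, one_mul]

theorem strictMono_blockEquiv_false (n : ℕ) :
    StrictMono fun i : Fin n => blockEquiv n (i, false) := fun _ _ h => blockEquiv_lt h _ _

theorem one_mem_oneFactors (n : ℕ) : (1 : Equiv.Perm (Fin (2 * n))) ∈ oneFactors n := by
  rw [mem_oneFactors]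
  refine ⟨strictMono_blockEquiv_false n, fun i => ?_⟩
  change 2 * (i : ℕ) + 0 < 2 * (i : ℕ) + 1
  omega

/-- Such a 1-factor pairs `2 t` with `2 t + 1` for every `t`, and the normalization of 1-factors
leaves only one ordering. -/
theorem eq_one_of_splitBlocks_eq_empty {n : ℕ} {π : Equiv.Perm (Fin (2 * n))}
    (hπ : π ∈ oneFactors n) (h : splitBlocks π = ∅) : π = 1 := by
  rw [mem_oneFactors] at hπ
  obtain ⟨h1, h2⟩ := hπ
  have hid := (mem_oneFactors _).1 (one_mem_oneFactors n)
  have key : ∀ t : Fin n, ∃ i : Fin n, ∀ b, π (blockEquiv n (i, b)) = blockEquiv n (t, b) := by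
    intro t
    have ht : block (π⁻¹ (blockEquiv n (t, false))) = block (π⁻¹ (blockEquiv n (t, true))) := by
      by_contra hne
      have : t ∈ splitBlocks π := by simpa [splitBlocks] using hne
      rw [h] at this
      simp at this
    obtain ⟨b, hb⟩ := eq_blockEquiv_block (π⁻¹ (blockEquiv n (t, false)))
    obtain ⟨c, hc⟩ := eq_blockEquiv_block (π⁻¹ (blockEquiv n (t, true)))
    rw [← ht] at hc
    set i := block (π⁻¹ (blockEquiv n (t, false)))
    rw [Equiv.Perm.inv_eq_iff_eq] at hb hc
    have hlt : blockEquiv n (t, false) < blockEquiv n (t, true) := hid.2 t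
    have hi := h2 i
    cases b <;> cases c
    · rw [hb, hc] at hlt; exact absurd hlt (lt_irrefl _)
    · exact ⟨i, by rintro (_ | _); exacts [hb.symm, hc.symm]⟩
    · rw [hb, hc] at hlt; exact absurd hlt hi.asymm
    · rw [hb, hc] at hlt; exact absurd hlt (lt_irrefl _)
  choose f hf using key
  have hinj : Function.Injective f := fun s t hst => by
    have := (hf s false).symm.trans ((congrArg (fun i => π (blockEquiv n (i, false))) hst).trans
      (hf t false))
    simpa using this
  have hsurj : Function.Surjective f := Finite.surjective_of_injective hinj
  have hr : (fun i => π (blockEquiv n (i, false))) = fun i => blockEquiv n (i, false) := by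
    rw [← StrictMono.range_inj h1 (strictMono_blockEquiv_false n)]
    ext y
    constructor
    · rintro ⟨i, rfl⟩
      obtain ⟨t, rfl⟩ := hsurj i
      exact ⟨t, (hf t false).symm⟩
    · rintro ⟨t, rfl⟩
      exact ⟨f t, hf t false⟩
  have hft : ∀ t, f t = t := fun t => by
    have h3 : blockEquiv n (f t, false) = blockEquiv n (t, false) :=
      (congrFun hr (f t)).symm.trans (hf t false)
    simpa using h3
  ext1 y
  obtain ⟨⟨i, b⟩, rfl⟩ := (blockEquiv n).surjective y
  have := hf i b
  rwa [hft] at this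

/-- The Pfaffian of the matrix with all entries above the diagonal equal to one. -/
theorem pf_ordSign (n : ℕ) : pf (ordSign : Fin (2 * n) → Fin (2 * n) → ℤ) = 1 := by
  have hne : (Fintype.card (Equiv.Perm (Fin n) × (Fin n → Bool)) : ℤ) ≠ 0 := by
    exact_mod_cast Fintype.card_ne_zero
  apply mul_left_cancel₀ hne
  rw [← pf_eq_sum_perm (fun i j => ordSign_antisymm i j)]
  have h1 := Finset.sum_filter_add_sum_filter_not Finset.univ
    (fun π : Equiv.Perm (Fin (2 * n)) => (splitBlocks π).Nonempty) (pfTerm ordSign)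
  rw [sum_pfTerm_split_eq_zero, zero_add] at h1
  -- Having no split block is invariant under block permutations, so the remaining sum again reduces
  -- to 1-factors, of which only the identity contributes.
  rw [← h1, Finset.sum_filter, sum_perm_eq_card_mul_sum_oneFactors]
  · congr 1
    rw [Finset.sum_eq_single_of_mem 1 (one_mem_oneFactors n)]
    · have hid := (mem_oneFactors _).1 (one_mem_oneFactors n)
      have h2 : ∀ i : Fin n, ordSign (blockEquiv n (i, false)) (blockEquiv n (i, true)) = 1 :=
        fun i => ordSign_of_lt (hid.2 i)
      rw [if_pos (by simp [splitBlocks])]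
      simp [pfTerm, h2]
    · intro π hπ hne
      rw [if_neg]
      intro h
      exact hne (eq_one_of_splitBlocks_eq_empty hπ (Finset.not_nonempty_iff_eq_empty.1 h))
  · intro π x
    rw [splitBlocks_mul_blockPerm, pfTerm_mul_blockPerm (fun i j => ordSign_antisymm i j)]

/-- A degenerate case of Schur's Pfaffian: the Pfaffian of the matrix of signs of the differences
of a sequence is the product of these signs. -/
theorem pf_ordSign_comp {α : Type*} [LinearOrder α] {n : ℕ} (k : Fin (2 * n) → α) :
    pf (fun i j => ordSign (k i) (k j)) = seqSign k := by
  have hA : ∀ (k : Fin (2 * n) → α) (i j), ordSign (k i) (k j) = -ordSign (k j) (k i) :=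
    fun k i j => ordSign_antisymm _ _
  by_cases hk : Function.Injective k
  · have hmono : StrictMono (k ∘ Tuple.sort k) :=
      (Tuple.monotone_sort k).strictMono_of_injective (hk.comp (Tuple.sort k).injective)
    have h1 := pf_comp_perm (hA k) (Tuple.sort k)
    have h2 : (fun i j => ordSign (k (Tuple.sort k i)) (k (Tuple.sort k j))) = ordSign := by
      funext i j
      exact ordSign_comp_strictMono hmono i j
    rw [h2, pf_ordSign] at h1
    have h3 := seqSign_comp_perm k (Tuple.sort k)
    rw [seqSign_of_strictMono hmono] at h3
    have hne : ((Equiv.Perm.sign (Tuple.sort k) : ℤˣ) : ℤ) ≠ 0 := Units.ne_zero _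
    exact mul_left_cancel₀ hne (h1.symm.trans h3)
  · simp only [Function.Injective, not_forall] at hk
    obtain ⟨a, b, hab, hne⟩ := hk
    rw [seqSign_eq_zero hne hab]
    -- Exchanging two equal values fixes the matrix but negates its Pfaffian.
    have h1 := pf_comp_perm (hA k) (Equiv.swap a b)
    have h2 : ∀ i, k (Equiv.swap a b i) = k i := by
      intro i
      by_cases ha : i = a
      · subst ha; simp [hab]
      · by_cases hb : i = b
        · subst hb; simp [hab]
        · rw [Equiv.swap_apply_of_ne_of_ne ha hb]
    simp only [h2, Equiv.Perm.sign_swap hne, Units.val_neg, Units.val_one] at h1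
    linarith

/-- The minor summation formula for the matrix of order signs. -/
theorem pf_gram {R κ : Type*} [CommRing R] [LinearOrder κ] [Fintype κ] {n : ℕ}
    (h : Fin (2 * n) → κ → R) :
    pf (fun i j => ∑ k, ∑ l, (ordSign k l : R) * (h i k * h j l)) =
      ∑ k : Fin (2 * n) → κ, (seqSign k : R) * ∏ j, h j (k j) := by
  have hpf : ∀ k : Fin (2 * n) → κ, (seqSign k : R) =
      ∑ π ∈ oneFactors n, ((Equiv.Perm.sign π : ℤ) : R) * ∏ i : Fin n,
        (ordSign (k (π (blockEquiv n (i, false)))) (k (π (blockEquiv n (i, true)))) : R) := by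
    intro k
    rw [← pf_ordSign_comp, pf]
    push_cast
    rfl
  simp only [hpf, Finset.sum_mul]
  rw [Finset.sum_comm, pf]
  refine Finset.sum_congr rfl fun π _ => ?_
  simp only [mul_assoc]
  rw [← Finset.mul_sum]
  congr 1
  simp only [← Fintype.sum_prod_type']
  rw [Fintype.prod_sum]
  -- A sequence is read as `n` pairs along the pairs of `π`; the summand factorizes over these.
  let e : (Fin (2 * n) → κ) ≃ (Fin n → κ × κ) :=
    { toFun := fun k i => (k (π (blockEquiv n (i, false))), k (π (blockEquiv n (i, true))))
      invFun := fun m y =>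
        if ((blockEquiv n).symm (π.symm y)).2 then (m ((blockEquiv n).symm (π.symm y)).1).2
        else (m ((blockEquiv n).symm (π.symm y)).1).1
      left_inv := by
        intro k
        funext y
        obtain ⟨x, rfl⟩ := π.surjective y
        obtain ⟨⟨i, _ | _⟩, rfl⟩ := (blockEquiv n).surjective x <;> simp
      right_inv := by
        intro m
        funext i
        simp }
  rw [← e.sum_comp]
  refine Finset.sum_congr rfl fun k _ => ?_
  rw [Finset.prod_mul_distrib]
  congr 1
  rw [← Equiv.prod_comp ((blockEquiv n).trans π) (fun j => h j (k j)), Fintype.prod_prod_type]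
  refine Finset.prod_congr rfl fun i _ => ?_
  simp [e, mul_comm]

/-! ### Row and column relations of letters, and tableaux in local form. -/

/-- `y` may follow `x` in a row. -/
def RowRel (x y : MarkedLetter) : Prop := x < y ∨ x = y ∧ ¬ x.IsMarked

/-- `y` may follow `x` in a column. -/
def ColRel (x y : MarkedLetter) : Prop := x < y ∨ x = y ∧ x.IsMarked

/-- This duality drives the cancellation: where a column condition fails, the two letters may be
neighbours in a row. -/
theorem not_rowRel {x y : MarkedLetter} : ¬ RowRel x y ↔ ColRel y x := by
  unfold RowRel ColRel
  rcases lt_trichotomy x y with h | rfl | h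
  · simp [h, h.asymm, h.ne']
  · simp
  · simp [h, h.asymm, h.ne']

theorem RowRel.le {x y : MarkedLetter} (h : RowRel x y) : x ≤ y :=
  h.elim le_of_lt fun h => h.1.le

theorem ColRel.le {x y : MarkedLetter} (h : ColRel x y) : x ≤ y :=
  h.elim le_of_lt fun h => h.1.le

theorem RowRel.trans {x y z : MarkedLetter} (h : RowRel x y) (h' : RowRel y z) :
    RowRel x z := by
  rcases h with h | ⟨rfl, _⟩
  · exact Or.inl (h.trans_le h'.le)
  · exact h'

theorem ColRel.trans {x y z : MarkedLetter} (h : ColRel x y) (h' : ColRel y z) :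
    ColRel x z := by
  rcases h with h | ⟨rfl, _⟩
  · exact Or.inl (h.trans_le h'.le)
  · exact h'

/-- Equality throughout would make one letter both unmarked and marked. -/
theorem RowRel.trans_colRel {x y z w : MarkedLetter} (h : RowRel x y) (h' : RowRel y z)
    (h'' : ColRel z w) : RowRel x w := by
  rcases (h.trans h') with h1 | ⟨rfl, h1⟩
  · exact Or.inl (h1.trans_le h''.le)
  · rcases h'' with h2 | ⟨_, h2⟩
    · exact Or.inl h2
    · exact absurd h2 h1

theorem MarkedLetter.abs_le_abs {x y : MarkedLetter} (h : x ≤ y) : x.abs ≤ y.abs := by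
  rcases Prod.Lex.le_iff.1 h with h | h
  · exact h.le
  · exact h.1.le

theorem abs_lt_abs_of_not_isMarked {x y : MarkedLetter} (h : x < y) (hx : ¬ x.IsMarked) :
    x.abs < y.abs := by
  rcases Prod.Lex.lt_iff.1 h with h | h
  · exact h
  · have h2 : (ofLex x).2 = true := by simpa [MarkedLetter.IsMarked] using hx
    rw [h2] at h
    exact absurd h.2 (by simp)

theorem abs_lt_abs_of_isMarked {x y : MarkedLetter} (h : x < y) (hy : y.IsMarked) :
    x.abs < y.abs := by
  rcases Prod.Lex.lt_iff.1 h with h | h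
  · exact h
  · have h2 : (ofLex y).2 = false := hy
    rw [h2] at h
    exact absurd h.2 (by simp)

/-- If `y` is marked the row step raises the absolute value, otherwise the column step does. Hence
absolute values increase strictly along the main diagonal. -/
theorem RowRel.abs_lt {x y z : MarkedLetter} (h : RowRel x y) (h' : ColRel y z) :
    x.abs < z.abs := by
  by_cases hy : y.IsMarked
  · rcases h with h | ⟨rfl, h⟩
    · exact (abs_lt_abs_of_isMarked h hy).trans_le (MarkedLetter.abs_le_abs h'.le)
    · exact absurd hy h
  · rcases h' with h' | ⟨_, h'⟩
    · exact (MarkedLetter.abs_le_abs h.le).trans_lt (abs_lt_abs_of_not_isMarked h' hy)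
    · exact absurd h' hy

theorem part_of_fin {m : ℕ} (lam : Fin m → ℕ) (j : Fin m) : part lam j = lam j := by
  simp [part]

theorem mem_shiftedDiagram_iff_part {m : ℕ} (lam : Fin m → ℕ) (b : ℕ × ℕ) :
    b ∈ shiftedDiagram lam ↔ b.1 ≤ b.2 ∧ b.2 - b.1 < part lam b.1 := by
  constructor
  · intro h
    obtain ⟨i, h1, h2, h3⟩ := (mem_shiftedDiagram _ _).1 h
    rw [h1, part_of_fin]
    omega
  · rintro ⟨h1, h2⟩
    have := mem_shiftedDiagram_of_lt_part lam h2
    rwa [Nat.add_sub_cancel' h1] at this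

theorem add_mem_shiftedDiagram_iff {m : ℕ} (lam : Fin m → ℕ) (i q : ℕ) :
    (i, i + q) ∈ shiftedDiagram lam ↔ q < part lam i := by
  rw [mem_shiftedDiagram_iff_part]
  simp

/-- The parts decrease strictly until they become zero. -/
def StrictUntilZero {m : ℕ} (lam : Fin m → ℕ) : Prop :=
  ∀ i j, i < j → 0 < part lam j → part lam j < part lam i

/-- The entry number `q` of the row `i`. -/
def entry {m : ℕ} {lam : Fin m → ℕ} (M : ShiftedTableau lam MarkedLetter) (i q : ℕ) :
    MarkedLetter :=
  if h : (i, i + q) ∈ shiftedDiagram lam then M ⟨_, h⟩ else toLex (1, true)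

theorem entry_eq {m : ℕ} {lam : Fin m → ℕ} (M : ShiftedTableau lam MarkedLetter) {i q : ℕ}
    (h : (i, i + q) ∈ shiftedDiagram lam) : entry M i q = M ⟨_, h⟩ := dif_pos h

theorem apply_eq_entry {m : ℕ} {lam : Fin m → ℕ} (M : ShiftedTableau lam MarkedLetter)
    (b : Box lam) : M b = entry M b.1.1 (b.1.2 - b.1.1) := by
  have h := ((mem_shiftedDiagram_iff_part lam b.1).1 b.2).1
  have h' : b.1 = (b.1.1, b.1.1 + (b.1.2 - b.1.1)) := Prod.ext rfl (by simp; omega)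
  rw [entry_eq M (h' ▸ b.2)]
  congr 1
  exact Subtype.ext h'

/-- The fillings that satisfy the conditions on rows. -/
def IsRowFilling {m : ℕ} {lam : Fin m → ℕ} (M : ShiftedTableau lam MarkedLetter) : Prop :=
  ∀ i q, q + 1 < part lam i → RowRel (entry M i q) (entry M i (q + 1))

/-- The condition on columns is violated between the entry `q + 1` of row `i` and the entry `q` of
row `i + 1`. -/
def Violation {m : ℕ} {lam : Fin m → ℕ} (M : ShiftedTableau lam MarkedLetter) (q i : ℕ) :
    Prop :=
  q < part lam (i + 1) ∧ RowRel (entry M (i + 1) q) (entry M i (q + 1))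

theorem IsRowFilling.rowRel {m : ℕ} {lam : Fin m → ℕ} {M : ShiftedTableau lam MarkedLetter}
    (h : IsRowFilling M) {i q q' : ℕ} (hq : q < q') (h' : q' < part lam i) :
    RowRel (entry M i q) (entry M i q') := by
  induction q', hq using Nat.le_induction with
  | base => exact h i q h'
  | succ n hn ih => exact (ih (by omega)).trans (h i n h')

/-- Conditions on adjacent rows chain together, since strictly decreasing parts keep the
intermediate boxes of the column in the diagram. -/
theorem colRel_of_no_violation {m : ℕ} {lam : Fin m → ℕ} (hlam : StrictUntilZero lam)
    {M : ShiftedTableau lam MarkedLetter} (h : ∀ q i, ¬ Violation M q i) (d i q : ℕ)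
    (hq : q < part lam (i + d + 1)) :
    ColRel (entry M i (q + d + 1)) (entry M (i + d + 1) q) := by
  have hadj : ∀ i q, q < part lam (i + 1) → ColRel (entry M i (q + 1)) (entry M (i + 1) q) := by
    intro i q hq
    rw [← not_rowRel]
    exact fun hr => h q i ⟨hq, hr⟩
  induction d generalizing q with
  | zero => exact hadj i q hq
  | succ d ih =>
    have h1 := hlam (i + d + 1) (i + (d + 1) + 1) (by omega) (by omega)
    have h2 := ih (q + 1) (by omega)
    have h3 := hadj (i + d + 1) q hq
    rw [show q + (d + 1) + 1 = q + 1 + d + 1 by ring]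
    exact h2.trans h3

theorem isQSST_iff {m : ℕ} {lam : Fin m → ℕ} (hlam : StrictUntilZero lam)
    (M : ShiftedTableau lam MarkedLetter) :
    IsQSST M ↔ IsRowFilling M ∧ ∀ q i, ¬ Violation M q i := by
  constructor
  · intro h
    constructor
    · intro i q hq
      have h1 := (add_mem_shiftedDiagram_iff lam i q).2 (by omega)
      have h2 := (add_mem_shiftedDiagram_iff lam i (q + 1)).2 hq
      rw [entry_eq M h1, entry_eq M h2]
      rcases (h.row_weak ⟨_, h1⟩ ⟨_, h2⟩ rfl (by simp)).lt_or_eq with h3 | h3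
      · exact Or.inl h3
      · refine Or.inr ⟨h3, fun h4 => ?_⟩
        simpa using h.row_marked ⟨_, h1⟩ ⟨_, h2⟩ rfl h3 h4
    · rintro q i ⟨hq, hr⟩
      have h0 := hlam i (i + 1) (by omega) (by omega)
      have h1 := (add_mem_shiftedDiagram_iff lam (i + 1) q).2 hq
      have h2 := (add_mem_shiftedDiagram_iff lam i (q + 1)).2 (by omega)
      rw [entry_eq M h1, entry_eq M h2] at hr
      have h3 := h.col_weak ⟨_, h2⟩ ⟨_, h1⟩ (by simp; omega) (by simp)
      rcases hr with hr | ⟨hr, hm⟩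
      · exact absurd hr (not_lt.2 h3)
      · simpa using h.col_unmarked _ _ (by simp; omega) hr hm
  · rintro ⟨hrow, hcol⟩
    have hrow' : ∀ b c : Box lam, b.1.1 = c.1.1 → b.1.2 < c.1.2 → RowRel (M b) (M c) := by
      intro b c h1 h2
      have hb := (mem_shiftedDiagram_iff_part lam b.1).1 b.2
      have hc := (mem_shiftedDiagram_iff_part lam c.1).1 c.2
      rw [apply_eq_entry M b, apply_eq_entry M c, h1]
      exact hrow.rowRel (by omega) hc.2
    have hcol' : ∀ b c : Box lam, b.1.2 = c.1.2 → b.1.1 < c.1.1 → ColRel (M b) (M c) := by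
      intro b c h1 h2
      have hb := (mem_shiftedDiagram_iff_part lam b.1).1 b.2
      have hc := (mem_shiftedDiagram_iff_part lam c.1).1 c.2
      rw [apply_eq_entry M b, apply_eq_entry M c]
      obtain ⟨d, hd⟩ : ∃ d, c.1.1 = b.1.1 + d + 1 := ⟨c.1.1 - b.1.1 - 1, by omega⟩
      have := colRel_of_no_violation hlam hcol d b.1.1 (c.1.2 - c.1.1) (by rw [← hd]; exact hc.2)
      rw [← hd] at this
      rwa [show c.1.2 - c.1.1 + d + 1 = b.1.2 - b.1.1 by omega] at this
    refine ⟨fun b c h1 h2 => ?_, fun b c h1 h2 => ?_, fun b c h1 h2 h3 => ?_,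
      fun b c h1 h2 h3 => ?_⟩
    · rcases h2.lt_or_eq with h2 | h2
      · exact (hrow' b c h1 h2).le
      · rw [Subtype.ext (Prod.ext h1 h2)]
    · rcases h2.lt_or_eq with h2 | h2
      · exact (hcol' b c h1 h2).le
      · rw [Subtype.ext (Prod.ext h2 h1)]
    · rcases lt_trichotomy b.1.2 c.1.2 with h4 | h4 | h4
      · rcases hrow' b c h1 h4 with h5 | h5
        · exact absurd h2 h5.ne
        · exact absurd h3 h5.2
      · exact Subtype.ext (Prod.ext h1 h4)
      · rcases hrow' c b h1.symm h4 with h5 | h5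
        · exact absurd h2 h5.ne'
        · exact absurd (h2 ▸ h3) h5.2
    · rcases lt_trichotomy b.1.1 c.1.1 with h4 | h4 | h4
      · rcases hcol' b c h1 h4 with h5 | h5
        · exact absurd h2 h5.ne
        · exact absurd h5.2 h3
      · exact Subtype.ext (Prod.ext h4 h1)
      · rcases hcol' c b h1.symm h4 with h5 | h5
        · exact absurd h2 h5.ne'
        · exact absurd h5.2 (h2 ▸ h3)

/-! ### The sign-reversing exchange of row prefixes. -/

/-- Exchange of the first `p + 1` boxes of the rows `i` and `i + 1`. -/
def prefixSwap (p i : ℕ) (b : ℕ × ℕ) : ℕ × ℕ :=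
  if b.1 = i ∧ b.2 ≤ i + p then (i + 1, b.2 + 1)
  else if b.1 = i + 1 ∧ b.2 ≤ i + 1 + p then (i, b.2 - 1) else b

theorem prefixSwap_mem {m : ℕ} {lam : Fin m → ℕ} (hlam : StrictUntilZero lam) {p i : ℕ}
    (hp : p < part lam (i + 1)) {b : ℕ × ℕ} (hb : b ∈ shiftedDiagram lam) :
    prefixSwap p i b ∈ shiftedDiagram lam := by
  have h0 := hlam i (i + 1) (by omega) (by omega)
  rw [mem_shiftedDiagram_iff_part] at hb ⊢
  unfold prefixSwap
  split_ifs with h1 h2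
  · simp only; omega
  · simp only; omega
  · exact hb

theorem prefixSwap_prefixSwap {p i : ℕ} {b : ℕ × ℕ} (hb : b.1 ≤ b.2) :
    prefixSwap p i (prefixSwap p i b) = b := by
  obtain ⟨x, y⟩ := b
  simp only at hb
  unfold prefixSwap
  simp only
  split_ifs <;> simp_all <;> omega

/-- `prefixSwap` as a permutation of the boxes. -/
def prefixPerm {m : ℕ} {lam : Fin m → ℕ} (hlam : StrictUntilZero lam) {p i : ℕ}
    (hp : p < part lam (i + 1)) : Equiv.Perm (Box lam) :=
  Function.Involutive.toPerm (fun b => ⟨prefixSwap p i b.1, prefixSwap_mem hlam hp b.2⟩)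
    fun b => Subtype.ext
      (prefixSwap_prefixSwap ((mem_shiftedDiagram_iff_part lam b.1).1 b.2).1)

theorem prefixPerm_prefixPerm {m : ℕ} {lam : Fin m → ℕ} (hlam : StrictUntilZero lam) {p i : ℕ}
    (hp : p < part lam (i + 1)) (b : Box lam) :
    prefixPerm hlam hp (prefixPerm hlam hp b) = b :=
  Subtype.ext (prefixSwap_prefixSwap ((mem_shiftedDiagram_iff_part lam b.1).1 b.2).1)

theorem content_prefixPerm {m : ℕ} {lam : Fin m → ℕ} (hlam : StrictUntilZero lam) {p i : ℕ}
    (hp : p < part lam (i + 1)) (b : Box lam) : content (prefixPerm hlam hp b) = content b := by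
  have hb := ((mem_shiftedDiagram_iff_part lam b.1).1 b.2).1
  change ((prefixSwap p i b.1).2 : ℤ) - (prefixSwap p i b.1).1 = (b.1.2 : ℤ) - b.1.1
  unfold prefixSwap
  split_ifs with h1 h2
  · simp only; push_cast; omega
  · simp only; omega
  · rfl

theorem entry_comp_prefixPerm {m : ℕ} {lam : Fin m → ℕ} (hlam : StrictUntilZero lam) {p i : ℕ}
    (hp : p < part lam (i + 1)) (M : ShiftedTableau lam MarkedLetter) (j q : ℕ) :
    entry (M ∘ prefixPerm hlam hp) j q =
      if q ≤ p then entry M (Equiv.swap i (i + 1) j) q else entry M j q := by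
  have h0 := hlam i (i + 1) (by omega) (by omega)
  have hval : ∀ (b : Box lam) (c : ℕ × ℕ) (hc : c ∈ shiftedDiagram lam),
      prefixSwap p i b.1 = c → (M ∘ prefixPerm hlam hp) b = M ⟨c, hc⟩ := by
    intro b c hc h
    exact congrArg M (Subtype.ext h)
  by_cases hj : (j, j + q) ∈ shiftedDiagram lam
  · rw [entry_eq _ hj]
    have hj' := (add_mem_shiftedDiagram_iff lam j q).1 hj
    split_ifs with hq
    · by_cases h1 : j = i
      · subst h1
        rw [Equiv.swap_apply_left]
        have h2 := (add_mem_shiftedDiagram_iff lam (j + 1) q).2 (by omega)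
        rw [entry_eq _ h2]
        apply hval
        simp only [prefixSwap]
        rw [if_pos ⟨trivial, by omega⟩]
        exact Prod.ext rfl (by simp only; omega)
      · by_cases h1' : j = i + 1
        · subst h1'
          rw [Equiv.swap_apply_right]
          have h2 := (add_mem_shiftedDiagram_iff lam i q).2 (by omega)
          rw [entry_eq _ h2]
          apply hval
          simp only [prefixSwap]
          rw [if_neg (by omega), if_pos ⟨trivial, by omega⟩]
          exact Prod.ext rfl (by simp only; omega)
        · rw [Equiv.swap_apply_of_ne_of_ne h1 h1', entry_eq _ hj]
          apply hval
          simp only [prefixSwap]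
          rw [if_neg (by tauto), if_neg (by tauto)]
    · rw [entry_eq _ hj]
      apply hval
      simp only [prefixSwap]
      rw [if_neg (by omega), if_neg (by omega)]
  · have hj' := fun h => hj ((add_mem_shiftedDiagram_iff lam j q).2 h)
    split_ifs with hq
    · have h1 : j ≠ i := by rintro rfl; exact hj' (by omega)
      have h2 : j ≠ i + 1 := by rintro rfl; exact hj' (by omega)
      rw [Equiv.swap_apply_of_ne_of_ne h1 h2, entry, entry, dif_neg hj, dif_neg hj]
    · rw [entry, entry, dif_neg hj, dif_neg hj]

/-- The violation with lexicographically maximal `(p, i)`. -/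
def IsTopViolation {m : ℕ} {lam : Fin m → ℕ} (M : ShiftedTableau lam MarkedLetter) (p i : ℕ) :
    Prop :=
  Violation M p i ∧ ∀ q j, Violation M q j → q < p ∨ q = p ∧ j ≤ i

theorem IsTopViolation.unique {m : ℕ} {lam : Fin m → ℕ} {M : ShiftedTableau lam MarkedLetter}
    {p i p' i' : ℕ} (h : IsTopViolation M p i) (h' : IsTopViolation M p' i') :
    p = p' ∧ i = i' := by
  have h1 := h.2 _ _ h'.1
  have h2 := h'.2 _ _ h.1
  omega

theorem exists_isTopViolation {m : ℕ} {lam : Fin m → ℕ} {M : ShiftedTableau lam MarkedLetter}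
    (h : ∃ q i, Violation M q i) : ∃ p i, IsTopViolation M p i := by
  classical
  obtain ⟨q, i, hqi⟩ := h
  let V : Finset (ℕ ×ₗ ℕ) :=
    ((shiftedDiagram lam).image fun b => toLex (b.2 - b.1, b.1 - 1)).filter
      fun x => Violation M (ofLex x).1 (ofLex x).2
  have hV : ∀ q i, Violation M q i → toLex (q, i) ∈ V := by
    intro q i h
    refine Finset.mem_filter.2 ⟨Finset.mem_image.2
      ⟨(i + 1, i + 1 + q), (add_mem_shiftedDiagram_iff lam _ _).2 h.1, ?_⟩, h⟩
    simp
  have hne : V.Nonempty := ⟨_, hV q i hqi⟩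
  refine ⟨(ofLex (V.max' hne)).1, (ofLex (V.max' hne)).2,
    (Finset.mem_filter.1 (V.max'_mem hne)).2, fun q j h => ?_⟩
  exact Prod.Lex.le_iff.1 (V.le_max' _ (hV q j h))

/-- The exchange finds the same `(p, i)` again, hence is an involution. The violation at `(p, i)`
becomes the old row relation of row `i`, and lexicographically later violations compare letters that
have not moved. -/
theorem IsTopViolation.comp_prefixPerm {m : ℕ} {lam : Fin m → ℕ} (hlam : StrictUntilZero lam)
    {M : ShiftedTableau lam MarkedLetter} (hM : IsRowFilling M) {p i : ℕ}
    (h : IsTopViolation M p i) : IsTopViolation (M ∘ prefixPerm hlam h.1.1) p i := by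
  have h0 := hlam i (i + 1) (by omega) (by have := h.1.1; omega)
  have hp := h.1.1
  refine ⟨⟨h.1.1, ?_⟩, ?_⟩
  · rw [entry_comp_prefixPerm, entry_comp_prefixPerm, if_pos le_rfl, if_neg (by omega),
      Equiv.swap_apply_right]
    exact hM i p (by omega)
  · rintro q j ⟨hq, hr⟩
    by_contra hcon
    rw [entry_comp_prefixPerm, entry_comp_prefixPerm, if_neg (by omega : ¬ q + 1 ≤ p)] at hr
    have : Violation M q j := by
      refine ⟨hq, ?_⟩
      split_ifs at hr with hqp
      · rwa [Equiv.swap_apply_of_ne_of_ne (by omega) (by omega)] at hr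
      · exact hr
    have := h.2 q j this
    omega

/-- Only the adjacencies at the cut are new. In row `i` it is the violation itself. In row `i + 1`
it follows by two steps along the old row `i` and one step down a column, which is allowed because
the violation at `(p, i)` is maximal. -/
theorem IsRowFilling.comp_prefixPerm {m : ℕ} {lam : Fin m → ℕ} (hlam : StrictUntilZero lam)
    {M : ShiftedTableau lam MarkedLetter} (hM : IsRowFilling M) {p i : ℕ}
    (h : IsTopViolation M p i) : IsRowFilling (M ∘ prefixPerm hlam h.1.1) := by
  have h0 := hlam i (i + 1) (by omega) (by have := h.1.1; omega)
  have hp := h.1.1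
  intro j q hq
  rw [entry_comp_prefixPerm, entry_comp_prefixPerm]
  rcases lt_trichotomy q p with hqp | rfl | hqp
  · rw [if_pos hqp.le, if_pos (by omega)]
    apply hM
    by_cases h1 : j = i
    · subst h1; rw [Equiv.swap_apply_left]; omega
    · by_cases h2 : j = i + 1
      · subst h2; rw [Equiv.swap_apply_right]; omega
      · rwa [Equiv.swap_apply_of_ne_of_ne h1 h2]
  · rw [if_pos le_rfl, if_neg (by omega)]
    by_cases h1 : j = i
    · subst h1
      rw [Equiv.swap_apply_left]
      exact h.1.2
    · by_cases h2 : j = i + 1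
      · subst h2
        rw [Equiv.swap_apply_right]
        have h3 : ColRel (entry M i (q + 1 + 1)) (entry M (i + 1) (q + 1)) := by
          rw [← not_rowRel]
          intro hr
          have := h.2 (q + 1) i ⟨hq, hr⟩
          omega
        exact (hM i q (by omega)).trans_colRel (hM i (q + 1) (by omega)) h3
      · rw [Equiv.swap_apply_of_ne_of_ne h1 h2]
        exact hM j q hq
  · rw [if_neg (by omega), if_neg (by omega)]
    exact hM j q hq

/-- The absolute values of the first entries of the rows; the empty row `j` has the value
`gh j`. -/
def rowStart {m : ℕ} {lam : Fin m → ℕ} (gh : Fin m → ℕ) (M : ShiftedTableau lam MarkedLetter)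
    (j : Fin m) : ℕ :=
  if lam j = 0 then gh j else (entry M j 0).abs

/-- The exchanged prefixes contain at least the first boxes, so the two row starts are transposed.
-/
theorem seqSign_rowStart_comp_prefixPerm {m : ℕ} {lam : Fin m → ℕ} (hlam : StrictUntilZero lam)
    (gh : Fin m → ℕ) {p i : ℕ} (hp : p < part lam (i + 1))
    (M : ShiftedTableau lam MarkedLetter) :
    seqSign (rowStart gh (M ∘ prefixPerm hlam hp)) = -seqSign (rowStart gh M) := by
  have h0 := hlam i (i + 1) (by omega) (by omega)
  have hm : i + 1 < m := by
    by_contra hcon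
    simp [part, hcon] at hp
  have hs : rowStart gh (M ∘ prefixPerm hlam hp) =
      rowStart gh M ∘ Equiv.swap ⟨i, by omega⟩ ⟨i + 1, hm⟩ := by
    have hi : lam ⟨i, by omega⟩ ≠ 0 := by
      have := part_of_fin lam ⟨i, by omega⟩; simp only at this; omega
    have hi' : lam ⟨i + 1, hm⟩ ≠ 0 := by
      have := part_of_fin lam ⟨i + 1, hm⟩; simp only at this; omega
    funext j
    simp only [rowStart, Function.comp_apply, entry_comp_prefixPerm, if_pos (Nat.zero_le p)]
    by_cases h1 : j = ⟨i, by omega⟩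
    · subst h1
      simp [hi, hi']
    · by_cases h2 : j = ⟨i + 1, hm⟩
      · subst h2
        simp [hi, hi']
      · rw [Equiv.swap_apply_of_ne_of_ne h1 h2, Equiv.swap_apply_of_ne_of_ne
          (fun h => h1 (Fin.ext h)) (fun h => h2 (Fin.ext h))]
  rw [hs, seqSign_comp_perm, Equiv.Perm.sign_swap (by simp)]
  simp

/-! ### Finite alphabets and the cancellation of non-tableaux. -/

/-- The letters of absolute value at most `N`. -/
def letters (N : ℕ) : Finset MarkedLetter :=
  ((Finset.univ : Finset (Fin N)) ×ˢ (Finset.univ : Finset Bool)).image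
    fun x => toLex (⟨(x.1 : ℕ) + 1, Nat.succ_pos _⟩, x.2)

theorem mem_letters {N : ℕ} {x : MarkedLetter} : x ∈ letters N ↔ (x.abs : ℕ) ≤ N := by
  simp only [letters, Finset.mem_image, Finset.mem_product, Finset.mem_univ, true_and]
  constructor
  · rintro ⟨⟨i, b⟩, rfl⟩
    exact i.2
  · intro h
    have h1 := x.abs.pos
    refine ⟨(⟨(x.abs : ℕ) - 1, by omega⟩, (ofLex x).2), ?_⟩
    apply ofLex.injective
    refine Prod.ext (PNat.eq ?_) rfl
    change (x.abs : ℕ) - 1 + 1 = x.abs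
    omega

/-- Starts of nonempty rows increase by `RowRel.abs_lt`. Empty rows come last, and their values `gh`
exceed every letter. -/
theorem strictMono_rowStart {m : ℕ} {lam : Fin m → ℕ} (hlam : StrictUntilZero lam) {N : ℕ}
    {gh : Fin m → ℕ} (hgh : StrictMono gh) (hN : ∀ j, N < gh j)
    {M : ShiftedTableau lam MarkedLetter} (hM : IsQSST M) (hMN : ∀ b, M b ∈ letters N) :
    StrictMono (rowStart gh M) := by
  obtain ⟨hrow, hcol⟩ := (isQSST_iff hlam M).1 hM
  have hadj : ∀ i, 0 < part lam (i + 1) → (entry M i 0).abs < (entry M (i + 1) 0).abs := by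
    intro i hi
    have h0 := hlam i (i + 1) (by omega) hi
    exact (hrow i 0 (by omega)).abs_lt (colRel_of_no_violation hlam hcol 0 i 0 hi)
  have hlt : ∀ d i, 0 < part lam (i + d + 1) →
      (entry M i 0).abs < (entry M (i + d + 1) 0).abs := by
    intro d
    induction d with
    | zero => exact hadj
    | succ d ih =>
      intro i hi
      have h0 := hlam (i + d + 1) (i + (d + 1) + 1) (by omega) hi
      exact (ih i (by omega)).trans (hadj _ hi)
  intro j k hjk
  unfold rowStart
  by_cases hk : lam k = 0
  · rw [if_pos hk]
    split_ifs with hj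
    · exact hgh hjk
    · have h1 := (add_mem_shiftedDiagram_iff lam j 0).2 (by rw [part_of_fin]; omega)
      rw [entry_eq M h1]
      exact (mem_letters.1 (hMN _)).trans_lt (hN k)
  · have hk' : 0 < part lam k := by rw [part_of_fin]; omega
    have h0 := hlam j k hjk hk'
    rw [part_of_fin lam j] at h0
    rw [if_neg hk, if_neg (by omega)]
    obtain ⟨d, hd⟩ : ∃ d, (k : ℕ) = j + d + 1 :=
      ⟨k - j - 1, by have : (j : ℕ) < k := hjk; omega⟩
    rw [hd] at hk' ⊢
    exact_mod_cast hlt d j hk'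

open Classical in
/-- The tableaux in `QSST(lam)` with letters of absolute value at most `N`. -/
noncomputable def boundedQSST {m : ℕ} (lam : Fin m → ℕ) (N : ℕ) :
    Finset (ShiftedTableau lam MarkedLetter) :=
  (Fintype.piFinset fun _ => letters N).filter IsQSST

open Classical in
/-- The row fillings with letters of absolute value at most `N`. -/
noncomputable def boundedRowFillings {m : ℕ} (lam : Fin m → ℕ) (N : ℕ) :
    Finset (ShiftedTableau lam MarkedLetter) :=
  (Fintype.piFinset fun _ => letters N).filter IsRowFilling

/-- The sum over tableaux is the signed sum over row fillings: all other row fillings cancel. -/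
theorem sum_boundedQSST_eq_sum_boundedRowFillings {R : Type*} [CommRing R] {m : ℕ}
    {lam : Fin m → ℕ} (hlam : StrictUntilZero lam) {N : ℕ} {gh : Fin m → ℕ}
    (hgh : StrictMono gh) (hN : ∀ j, N < gh j) (x : ℤ → MarkedLetter → R) :
    ∑ M ∈ boundedQSST lam N, ∏ b, x (content b) (M b) =
      ∑ M ∈ boundedRowFillings lam N,
        (seqSign (rowStart gh M) : R) * ∏ b, x (content b) (M b) := by
  classical
  rw [← Finset.sum_filter_add_sum_filter_not (boundedRowFillings lam N) IsQSST]
  have h1 : (boundedRowFillings lam N).filter IsQSST = boundedQSST lam N := by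
    ext M
    simp only [boundedRowFillings, boundedQSST, Finset.mem_filter]
    exact ⟨fun h => ⟨h.1.1, h.2⟩, fun h => ⟨⟨h.1, ((isQSST_iff hlam M).1 h.2).1⟩, h.2⟩⟩
  have htop : ∀ M ∈ (boundedRowFillings lam N).filter (fun M => ¬ IsQSST M),
      ∃ p i, IsTopViolation M p i := by
    intro M hM
    simp only [boundedRowFillings, Finset.mem_filter] at hM
    apply exists_isTopViolation
    by_contra hcon
    push Not at hcon
    exact hM.2 ((isQSST_iff hlam M).2 ⟨hM.1.2, hcon⟩)
  choose! p i hpi using htop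
  have h2 : ∑ M ∈ (boundedRowFillings lam N).filter (fun M => ¬ IsQSST M),
      (seqSign (rowStart gh M) : R) * ∏ b, x (content b) (M b) = 0 := by
    have hmem : ∀ M (hM : M ∈ (boundedRowFillings lam N).filter (fun M => ¬ IsQSST M)),
        M ∘ prefixPerm hlam (hpi M hM).1.1 ∈
          (boundedRowFillings lam N).filter (fun M => ¬ IsQSST M) := by
      intro M hM
      have hM' := hM
      simp only [boundedRowFillings, Finset.mem_filter, Fintype.mem_piFinset] at hM' ⊢
      refine ⟨⟨fun b => hM'.1.1 _, hM'.1.2.comp_prefixPerm hlam (hpi M hM)⟩, fun hq => ?_⟩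
      exact ((isQSST_iff hlam _).1 hq).2 _ _
        (IsTopViolation.comp_prefixPerm hlam hM'.1.2 (hpi M hM)).1
    refine Finset.sum_involution (fun M hM => M ∘ prefixPerm hlam (hpi M hM).1.1)
      (fun M hM => ?_) (fun M hM hne heq => ?_) hmem (fun M hM => ?_)
    · rw [seqSign_rowStart_comp_prefixPerm]
      have : ∏ b, x (content b) ((M ∘ prefixPerm hlam (hpi M hM).1.1) b) =
          ∏ b, x (content b) (M b) := by
        rw [← Equiv.prod_comp (prefixPerm hlam (hpi M hM).1.1) (fun b => x (content b) (M b))]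
        exact Finset.prod_congr rfl fun b _ => by rw [content_prefixPerm]; rfl
      rw [this]
      push_cast
      ring
    · apply hne
      -- A fixed filling has sign equal to its negative. The sign is seen to vanish in `ℤ`, as `R`
      -- may have characteristic two.
      have := seqSign_rowStart_comp_prefixPerm hlam gh (hpi M hM).1.1 M
      rw [heq] at this
      have : seqSign (rowStart gh M) = 0 := by linarith
      rw [this]
      simp
    · have hM' := hM
      simp only [boundedRowFillings, Finset.mem_filter] at hM'
      obtain ⟨e1, e2⟩ := (hpi _ (hmem M hM)).unique
        (IsTopViolation.comp_prefixPerm hlam hM'.1.2 (hpi M hM))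
      funext b
      simp only [Function.comp_apply]
      -- The indices of the second exchange are generalized so that their equality with the first
      -- ones can be substituted in the dependent permutation.
      have : ∀ (p' i' : ℕ) (hp' : p' < part lam (i' + 1)) (hp'' : p M < part lam (i M + 1)),
          p' = p M → i' = i M →
          M (prefixPerm hlam hp'' (prefixPerm hlam hp' b)) = M b := by
        rintro p' i' hp' hp'' rfl rfl
        rw [prefixPerm_prefixPerm]
      exact this _ _ _ _ e1 e2
  rw [h1, h2, add_zero]
  refine Finset.sum_congr rfl fun M hM => ?_
  simp only [boundedQSST, Finset.mem_filter, Fintype.mem_piFinset] at hM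
  rw [seqSign_of_strictMono (strictMono_rowStart hlam hgh hN hM.2 hM.1)]
  simp

/-! ### Decoupling of the rows and the Pfaffian formula in finitely many letters. -/

/-- The boxes in coordinates: row and position in the row. -/
def boxEquiv {m : ℕ} (lam : Fin m → ℕ) : (Σ j : Fin m, Fin (lam j)) ≃ Box lam where
  toFun x := ⟨((x.1 : ℕ), x.1 + x.2), (add_mem_shiftedDiagram_iff lam _ _).2
    (by rw [part_of_fin]; exact x.2.2)⟩
  invFun b :=
    have h := (mem_shiftedDiagram_iff_part lam b.1).1 b.2
    have hm : b.1.1 < m := by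
      by_contra hcon
      simp [part, hcon] at h
    ⟨⟨b.1.1, hm⟩, ⟨b.1.2 - b.1.1, by
      have := part_of_fin lam ⟨b.1.1, hm⟩
      simp only at this
      omega⟩⟩
  left_inv := by
    rintro ⟨j, q⟩
    simp
  right_inv := by
    rintro ⟨⟨y, z⟩, hb⟩
    have := ((mem_shiftedDiagram_iff_part lam (y, z)).1 hb).1
    simp only at this
    simp only [Subtype.mk.injEq, Prod.mk.injEq, true_and]
    omega

theorem content_boxEquiv {m : ℕ} (lam : Fin m → ℕ) (j : Fin m) (q : Fin (lam j)) :
    content (boxEquiv lam ⟨j, q⟩) = (q : ℕ) := by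
  simp [content, boxEquiv]

/-- The condition on the fillings of a single row. -/
def IsRowWord {L : ℕ} (u : Fin L → MarkedLetter) : Prop :=
  ∀ q (h : q + 1 < L), RowRel (u ⟨q, by omega⟩) (u ⟨q + 1, h⟩)

open Classical in
/-- The fillings of a row of length `L` with letters of absolute value at most `N`. -/
noncomputable def rowWords (L N : ℕ) : Finset (Fin L → MarkedLetter) :=
  (Fintype.piFinset fun _ => letters N).filter IsRowWord

/-- The absolute value of the first letter, or `g` for the empty word. -/
def wordStart {L : ℕ} (g : ℕ) (u : Fin L → MarkedLetter) : ℕ :=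
  if h : L = 0 then g else (u ⟨0, Nat.pos_of_ne_zero h⟩).abs

/-- The generating function of the fillings of a row with given start. -/
noncomputable def rowSum {R : Type*} [CommRing R] (x : ℤ → MarkedLetter → R) (L N g k : ℕ) : R :=
  ∑ u ∈ rowWords L N, if wordStart g u = k then ∏ q : Fin L, x (q : ℕ) (u q) else 0

theorem isRowFilling_iff {m : ℕ} {lam : Fin m → ℕ} (M : ShiftedTableau lam MarkedLetter) :
    IsRowFilling M ↔ ∀ j : Fin m, IsRowWord fun q => M (boxEquiv lam ⟨j, q⟩) := by
  have key : ∀ (j : Fin m) (q : Fin (lam j)), M (boxEquiv lam ⟨j, q⟩) = entry M j q :=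
    fun j q => (entry_eq M _).symm
  simp only [IsRowFilling, IsRowWord, key]
  constructor
  · intro h j q hq
    exact h j q (by rwa [part_of_fin])
  · intro h i q hq
    have hm : i < m := by
      by_contra hcon
      simp [part, hcon] at hq
    exact h ⟨i, hm⟩ q (by rwa [← part_of_fin lam ⟨i, hm⟩])

theorem rowStart_eq_wordStart {m : ℕ} {lam : Fin m → ℕ} (gh : Fin m → ℕ)
    (M : ShiftedTableau lam MarkedLetter) (j : Fin m) :
    rowStart gh M j = wordStart (gh j) fun q => M (boxEquiv lam ⟨j, q⟩) := by
  unfold rowStart wordStart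
  split_ifs with h
  · rfl
  · have h1 := (add_mem_shiftedDiagram_iff lam j 0).2 (by rw [part_of_fin]; omega)
    rw [entry_eq M h1]
    rfl

theorem seqSign_comp_strictMono {α β : Type*} [LinearOrder α] [LinearOrder β] {f : α → β}
    (hf : StrictMono f) {m : ℕ} (k : Fin m → α) : seqSign (f ∘ k) = seqSign k := by
  simp only [seqSign, Function.comp_apply, ordSign_comp_strictMono hf]

theorem wordStart_lt {L N K g : ℕ} (hg : g < K) (hN : N < K) {u : Fin L → MarkedLetter}
    (hu : u ∈ rowWords L N) : wordStart g u < K := by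
  unfold wordStart
  split_ifs with h
  · exact hg
  · simp only [rowWords, Finset.mem_filter, Fintype.mem_piFinset] at hu
    exact (mem_letters.1 (hu.1 _)).trans_lt hN

/-- Once the starts `k` are prescribed, the sign is constant and the rows can be filled
independently. -/
theorem sum_boundedRowFillings {R : Type*} [CommRing R] {m : ℕ} (lam : Fin m → ℕ) {N K : ℕ}
    {gh : Fin m → ℕ} (hgh : ∀ j, gh j < K) (hN : N < K) (x : ℤ → MarkedLetter → R) :
    ∑ M ∈ boundedRowFillings lam N,
        (seqSign (rowStart gh M) : R) * ∏ b, x (content b) (M b) =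
      ∑ k : Fin m → Fin K, (seqSign k : R) * ∏ j, rowSum x (lam j) N (gh j) (k j) := by
  classical
  simp only [rowSum, Finset.prod_univ_sum, Finset.mul_sum]
  rw [Finset.sum_comm]
  have hround : ∀ (f : (j : Fin m) → Fin (lam j) → MarkedLetter) (j : Fin m) (q : Fin (lam j)),
      f ((boxEquiv lam).symm (boxEquiv lam ⟨j, q⟩)).1
        ((boxEquiv lam).symm (boxEquiv lam ⟨j, q⟩)).2 = f j q := by
    intro f j q
    rw [Equiv.symm_apply_apply]
  refine Finset.sum_bij'
    (fun M _ j q => M (boxEquiv lam ⟨j, q⟩))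
    (fun f _ b => f ((boxEquiv lam).symm b).1 ((boxEquiv lam).symm b).2) ?_ ?_ ?_ ?_ ?_
  · intro M hM
    simp only [boundedRowFillings, rowWords, Finset.mem_filter, Fintype.mem_piFinset] at hM ⊢
    exact fun j => ⟨fun q => hM.1 _, (isRowFilling_iff M).1 hM.2 j⟩
  · intro f hf
    simp only [boundedRowFillings, rowWords, Finset.mem_filter, Fintype.mem_piFinset] at hf ⊢
    refine ⟨fun b => (hf _).1 _, (isRowFilling_iff _).2 fun j => ?_⟩
    simp only [hround f]
    exact (hf j).2
  · intro M hM
    funext b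
    simp
  · intro f hf
    funext j q
    exact hround f j q
  · intro M hM
    simp only [boundedRowFillings, Finset.mem_filter, Fintype.mem_piFinset] at hM
    have hW : ∀ j, (fun q => M (boxEquiv lam ⟨j, q⟩)) ∈ rowWords (lam j) N := fun j => by
      simp only [rowWords, Finset.mem_filter, Fintype.mem_piFinset]
      exact ⟨fun q => hM.1 _, (isRowFilling_iff M).1 hM.2 j⟩
    let k0 : Fin m → Fin K := fun j => ⟨rowStart gh M j, by
      rw [rowStart_eq_wordStart]; exact wordStart_lt (hgh j) hN (hW j)⟩
    have hk0 : ∀ j, (k0 j : ℕ) = wordStart (gh j) fun q => M (boxEquiv lam ⟨j, q⟩) :=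
      fun j => rowStart_eq_wordStart gh M j
    rw [Finset.sum_eq_single k0]
    · rw [← seqSign_comp_strictMono Fin.val_strictMono k0]
      congr 1
      rw [← Equiv.prod_comp (boxEquiv lam), Fintype.prod_sigma]
      refine Finset.prod_congr rfl fun j _ => ?_
      rw [if_pos (hk0 j).symm]
      exact Finset.prod_congr rfl fun q _ => by rw [content_boxEquiv]
    · intro k _ hk
      obtain ⟨j, hj⟩ := Function.ne_iff.1 hk
      rw [Finset.prod_eq_zero (Finset.mem_univ j), mul_zero]
      rw [if_neg]
      intro h
      exact hj (Fin.ext (h.symm.trans (hk0 j).symm))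
    · simp

theorem strictUntilZero_pair {a c : ℕ} (h : 0 < c → c < a) : StrictUntilZero ![a, c] := by
  intro i j hij hj
  rcases j with _ | _ | j
  · omega
  · obtain rfl : i = 0 := by omega
    exact h (by simpa [part] using hj)
  · simp [part] at hj

theorem seqSign_pair {α : Type*} [LinearOrder α] (k : Fin 2 → α) :
    seqSign k = ordSign (k 0) (k 1) := by
  have h0 : Finset.Iio (0 : Fin 2) = ∅ := by decide
  have h1 : Finset.Iio (1 : Fin 2) = {0} := by decide
  simp [seqSign, Fin.prod_univ_two, h0, h1]

/-- The Pfaffian formula for Schur `Q`-functions in finitely many letters whose variables depend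
on the diagonal. -/
theorem sum_boundedQSST_eq_pf {R : Type*} [CommRing R] {n : ℕ} {mu : Fin (2 * n) → ℕ}
    (hmu : StrictUntilZero mu) (N : ℕ) (x : ℤ → MarkedLetter → R) :
    ∑ M ∈ boundedQSST mu N, ∏ b, x (content b) (M b) =
      pf fun i j => ∑ M ∈ boundedQSST ![mu i, mu j] N, ∏ b, x (content b) (M b) := by
  -- Ghost starts for empty rows lie beyond all letters and increase with the row. The matrix
  -- entries use the same ghosts, so that the row sums match.
  set gh : Fin (2 * n) → ℕ := fun j => N + 1 + j with hgh
  have hmono : StrictMono gh := fun i j h => by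
    have : (i : ℕ) < j := h
    simp only [hgh]; omega
  have hNgh : ∀ j, N < gh j := fun j => by simp only [hgh]; omega
  have hK : ∀ j, gh j < N + 1 + 2 * n := fun j => by simp only [hgh]; omega
  rw [sum_boundedQSST_eq_sum_boundedRowFillings hmu hmono hNgh x,
    sum_boundedRowFillings mu hK (by omega) x, 
    ← pf_gram fun j (k : Fin (N + 1 + 2 * n)) => rowSum x (mu j) N (gh j) k]
  refine pf_congr fun i j hij => ?_
  have h2 : StrictUntilZero ![mu i, mu j] := strictUntilZero_pair fun h => by
    have := hmu i j hij
    simp only [part_of_fin] at this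
    exact this h
  have hmono2 : StrictMono ![gh i, gh j] := by
    intro p q hpq
    have hpq' : (p : ℕ) < q := hpq
    obtain rfl : p = 0 := Fin.ext (by simp; omega)
    obtain rfl : q = 1 := Fin.ext (by simp; omega)
    exact hmono hij
  -- The same expansion for two rows gives the entry in the form required by `pf_gram`.
  rw [sum_boundedQSST_eq_sum_boundedRowFillings h2 hmono2
      (fun p => by fin_cases p <;> simp [hNgh]) x,
    sum_boundedRowFillings ![mu i, mu j] (K := N + 1 + 2 * n)
      (fun p => by fin_cases p <;> simp [hK]) (by omega) x,
    ← (finTwoArrowEquiv _).symm.sum_comp, Fintype.sum_prod_type]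
  refine Finset.sum_congr rfl fun k _ => Finset.sum_congr rfl fun l _ => ?_
  rw [seqSign_pair, Fin.prod_univ_two]
  rfl

/-! ### Symmetrization over the diagonals by extracting a multilinear coefficient. -/

/-- The generic variable of the diagonal `d` for the letter `a`. -/
noncomputable def diagVar {r : ℕ} {lam : Fin r → ℕ} (y : Box lam → MarkedLetter → ℂ) (d : ℤ)
    (a : MarkedLetter) : MvPolynomial (Box lam) ℂ :=
  ∑ b : Box lam with content b = d, MvPolynomial.X b * MvPolynomial.C (y b a)

theorem sum_single_comp_eq_iff {ι : Type*} [Fintype ι] (φ : ι → ι) :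
    ∑ b, Finsupp.single (φ b) 1 = ∑ b, (Finsupp.single b 1 : ι →₀ ℕ) ↔
      Function.Bijective φ := by
  classical
  constructor
  · intro h
    apply Function.Surjective.bijective_of_finite
    intro c
    by_contra hcon
    push Not at hcon
    have h1 := DFunLike.congr_fun h c
    simp [Finsupp.finsetSum_apply, Finsupp.single_apply, hcon] at h1
  · intro h
    exact (Equiv.ofBijective φ h).sum_comp fun b => Finsupp.single b 1

/-- The multilinear coefficient of a product of diagonal variables is the symmetrization over the
diagonal permutations. -/
theorem coeff_prod_diagVar {r : ℕ} {lam : Fin r → ℕ} (y : Box lam → MarkedLetter → ℂ)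
    (M : Box lam → MarkedLetter) :
    MvPolynomial.coeff (∑ b, Finsupp.single b 1) (∏ b, diagVar y (content b) (M b)) =
      ∑ σ ∈ diagPerms lam, ∏ b, y (σ b) (M b) := by
  classical
  have hmon : ∀ φ : Box lam → Box lam,
      ∏ b, (MvPolynomial.X (φ b) * MvPolynomial.C (y (φ b) (M b)) : MvPolynomial (Box lam) ℂ) =
        MvPolynomial.monomial (∑ b, Finsupp.single (φ b) 1) (∏ b, y (φ b) (M b)) := by
    intro φ
    rw [MvPolynomial.monomial_sum_prod]
    refine Finset.prod_congr rfl fun b _ => ?_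
    rw [mul_comm, MvPolynomial.C_mul_X_eq_monomial]
  simp only [diagVar, Finset.prod_univ_sum, MvPolynomial.coeff_sum, hmon,
    MvPolynomial.coeff_monomial, sum_single_comp_eq_iff]
  rw [← Finset.sum_filter]
  symm
  refine Finset.sum_bij (fun σ _ => σ) ?_ ?_ ?_ ?_
  · intro σ hσ
    simp only [diagPerms, Finset.mem_filter, Finset.mem_univ, true_and] at hσ
    simp only [Finset.mem_filter, Fintype.mem_piFinset, Finset.mem_univ, true_and]
    exact ⟨hσ, σ.bijective⟩
  · intro σ _ τ _ h
    exact Equiv.coe_fn_injective h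
  · intro φ hφ
    simp only [Finset.mem_filter, Fintype.mem_piFinset, Finset.mem_univ, true_and] at hφ
    exact ⟨Equiv.ofBijective φ hφ.2, by simpa [diagPerms] using hφ.1, rfl⟩
  · intro σ _
    rfl

/-- Needed with `E` the disjoint union of the two-row shapes of a 1-factor. -/
theorem coeff_prod_diagVar_comp {r : ℕ} {lam : Fin r → ℕ} (y : Box lam → MarkedLetter → ℂ)
    {E : Type*} [Fintype E] {q : E → Box lam} (hq : Function.Bijective q)
    (M : E → MarkedLetter) :
    MvPolynomial.coeff (∑ b, Finsupp.single b 1) (∏ e, diagVar y (content (q e)) (M e)) =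
      ∑ σ ∈ diagPerms lam, ∏ e, y (σ (q e)) (M e) := by
  have h := coeff_prod_diagVar y (M ∘ (Equiv.ofBijective q hq).symm)
  rw [← Equiv.prod_comp (Equiv.ofBijective q hq)] at h
  simp only [← Equiv.prod_comp (Equiv.ofBijective q hq) (fun b => y _ _)] at h
  simpa using h

/-- The box of `lam` that belongs to a box of the two-row shape `(lam i, lam j)`. -/
def rowsEmb {r : ℕ} (lam : Fin r → ℕ) (i j : ℕ) (b : Box ![part lam i, part lam j]) :
    Box lam :=
  if h : b.1.1 = 0 then
    ⟨(i, i + b.1.2), mem_shiftedDiagram_of_lt_part lam (lt_of_fst_eq_zero b h)⟩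
  else ⟨(j, j + (b.1.2 - 1)), mem_shiftedDiagram_of_lt_part lam (lt_of_fst_ne_zero b h)⟩

theorem twoRows_eq_comp_rowsEmb {r : ℕ} (lam : Fin r → ℕ) (s : ShiftedTableau lam ℂ)
    (i j : ℕ) : twoRows lam s i j = s ∘ rowsEmb lam i j := by
  funext b
  simp only [twoRows, rowsEmb, Function.comp_apply]
  split_ifs <;> rfl

theorem fst_cases {a c : ℕ} (b : Box ![a, c]) :
    b.1.1 = 0 ∨ b.1.1 = 1 ∧ 1 ≤ b.1.2 := by
  obtain ⟨i, h1, h2, h3⟩ := (mem_shiftedDiagram _ _).1 b.2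
  have := i.2
  omega

theorem rowsEmb_of_eq_zero {r : ℕ} (lam : Fin r → ℕ) {i j : ℕ}
    {b : Box ![part lam i, part lam j]} (h : b.1.1 = 0) :
    (rowsEmb lam i j b).1 = (i, i + b.1.2) := by
  rw [rowsEmb, dif_pos h]

theorem rowsEmb_of_ne_zero {r : ℕ} (lam : Fin r → ℕ) {i j : ℕ}
    {b : Box ![part lam i, part lam j]} (h : b.1.1 ≠ 0) :
    (rowsEmb lam i j b).1 = (j, j + (b.1.2 - 1)) := by
  rw [rowsEmb, dif_neg h]

theorem content_rowsEmb {r : ℕ} (lam : Fin r → ℕ) (i j : ℕ)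
    (b : Box ![part lam i, part lam j]) : content (rowsEmb lam i j b) = content b := by
  unfold content
  rcases fst_cases b with h | ⟨h, h'⟩
  · rw [rowsEmb_of_eq_zero lam h, h]
    push_cast
    ring
  · rw [rowsEmb_of_ne_zero lam (by omega), h]
    push_cast [h']
    ring

/-- The 1-factor `π` uses every row exactly once, and padded rows are empty. -/
theorem bijective_rowsEmb {r n : ℕ} (lam : Fin r → ℕ) (hn : r ≤ 2 * n)
    (π : Equiv.Perm (Fin (2 * n))) :
    Function.Bijective
      fun x : Σ t : Fin n, Box ![part lam (π (blockEquiv n (t, false))),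
        part lam (π (blockEquiv n (t, true)))] => rowsEmb lam _ _ x.2 := by
  constructor
  · rintro ⟨t, b⟩ ⟨t', b'⟩ h
    have h1 := congrArg Subtype.val h
    simp only at h1
    have hinj : ∀ {t t' : Fin n} {c c' : Bool},
        (π (blockEquiv n (t, c)) : ℕ) = π (blockEquiv n (t', c')) → t = t' ∧ c = c' := by
      intro t t' c c' h
      simpa using (blockEquiv n).injective (π.injective (Fin.ext h))
    rcases fst_cases b with hb | ⟨hb, hb1⟩ <;> rcases fst_cases b' with hb' | ⟨hb', hb1'⟩
    · rw [rowsEmb_of_eq_zero lam hb, rowsEmb_of_eq_zero lam hb', Prod.mk.injEq] at h1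
      obtain ⟨rfl, -⟩ := hinj h1.1
      obtain rfl : b = b' := Subtype.ext (Prod.ext (hb.trans hb'.symm) (by omega))
      rfl
    · rw [rowsEmb_of_eq_zero lam hb, rowsEmb_of_ne_zero lam (by omega), Prod.mk.injEq] at h1
      simpa using (hinj h1.1).2
    · rw [rowsEmb_of_ne_zero lam (by omega), rowsEmb_of_eq_zero lam hb', Prod.mk.injEq] at h1
      simpa using (hinj h1.1).2
    · rw [rowsEmb_of_ne_zero lam (by omega), rowsEmb_of_ne_zero lam (by omega),
        Prod.mk.injEq] at h1
      obtain ⟨rfl, -⟩ := hinj h1.1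
      obtain rfl : b = b' := Subtype.ext (Prod.ext (hb.trans hb'.symm) (by omega))
      rfl
  · intro c
    have hc := (mem_shiftedDiagram_iff_part lam c.1).1 c.2
    have hcr : c.1.1 < r := by
      by_contra hcon
      simp [part, hcon] at hc
    obtain ⟨x, hx⟩ := π.surjective ⟨c.1.1, by omega⟩
    obtain ⟨⟨t, β⟩, rfl⟩ := (blockEquiv n).surjective x
    have hx' : (π (blockEquiv n (t, β)) : ℕ) = c.1.1 := congrArg Fin.val hx
    cases β
    · have hmem : (0, c.1.2 - c.1.1) ∈ shiftedDiagram ![part lam (π (blockEquiv n (t, false))),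
          part lam (π (blockEquiv n (t, true)))] := by
        rw [mem_shiftedDiagram_iff_part, hx']
        exact ⟨by simp, by simpa [part] using hc.2⟩
      refine ⟨⟨t, ⟨_, hmem⟩⟩, Subtype.ext ?_⟩
      simp only
      rw [rowsEmb_of_eq_zero lam rfl]
      exact Prod.ext hx' (by simp only; omega)
    · have hmem : (1, 1 + (c.1.2 - c.1.1)) ∈
          shiftedDiagram ![part lam (π (blockEquiv n (t, false))),
            part lam (π (blockEquiv n (t, true)))] := by
        rw [add_mem_shiftedDiagram_iff, hx']
        simpa [part] using hc.2
      refine ⟨⟨t, ⟨_, hmem⟩⟩, Subtype.ext ?_⟩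
      simp only
      rw [rowsEmb_of_ne_zero lam (by simp)]
      exact Prod.ext hx' (by simp only; omega)

theorem IsQSST.comp {m r : ℕ} {mu : Fin m → ℕ} {lam : Fin r → ℕ}
    {M : ShiftedTableau lam MarkedLetter} (hM : IsQSST M) {e : Box mu → Box lam}
    (he : ∀ b, (e b).1 = b.1) : IsQSST (M ∘ e) where
  row_weak b c h1 h2 := hM.row_weak _ _ (by rwa [he, he]) (by rwa [he, he])
  col_weak b c h1 h2 := hM.col_weak _ _ (by rwa [he, he]) (by rwa [he, he])
  row_marked b c h1 h2 h3 := by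
    have := congrArg Subtype.val (hM.row_marked _ _ (by rwa [he, he]) h2 h3)
    rw [he, he] at this
    exact Subtype.ext this
  col_unmarked b c h1 h2 h3 := by
    have := congrArg Subtype.val (hM.col_unmarked _ _ (by rwa [he, he]) h2 h3)
    rw [he, he] at this
    exact Subtype.ext this

/-- The sum over tableaux depends only on the diagram. -/
theorem sum_boundedQSST_congr {R : Type*} [CommRing R] {m r : ℕ} {mu : Fin m → ℕ}
    {lam : Fin r → ℕ} (h : shiftedDiagram mu = shiftedDiagram lam) (N : ℕ)
    (x : ℤ → MarkedLetter → R) :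
    ∑ M ∈ boundedQSST lam N, ∏ b, x (content b) (M b) =
      ∑ M ∈ boundedQSST mu N, ∏ b, x (content b) (M b) := by
  classical
  let e : Box mu ≃ Box lam := Equiv.subtypeEquivRight fun b => by rw [h]
  refine Finset.sum_bij' (fun M _ => M ∘ e) (fun M _ => M ∘ e.symm) ?_ ?_ ?_ ?_ ?_
  · intro M hM
    simp only [boundedQSST, Finset.mem_filter, Fintype.mem_piFinset] at hM ⊢
    exact ⟨fun b => hM.1 _, hM.2.comp fun b => rfl⟩
  · intro M hM
    simp only [boundedQSST, Finset.mem_filter, Fintype.mem_piFinset] at hM ⊢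
    exact ⟨fun b => hM.1 _, hM.2.comp fun b => rfl⟩
  · intro M _
    rfl
  · intro M _
    rfl
  · intro M _
    rw [← e.prod_comp]
    rfl

/-- The identity in finitely many letters, for arbitrary weights. -/
theorem sum_diagPerms_boundedQSST {r n : ℕ} {lam : Fin r → ℕ} (hlam : StrictAnti lam)
    (hn : r ≤ 2 * n) (N : ℕ) (y : Box lam → MarkedLetter → ℂ) :
    ∑ σ ∈ diagPerms lam, ∑ M ∈ boundedQSST lam N, ∏ b, y (σ b) (M b) =
      ∑ σ ∈ diagPerms lam, pf fun i j : Fin (2 * n) =>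
        ∑ M ∈ boundedQSST ![part lam i, part lam j] N, ∏ b, y (σ (rowsEmb lam i j b)) (M b) := by
  classical
  set mu : Fin (2 * n) → ℕ := fun j => part lam j with hmu
  have hpart : ∀ k, part mu k = part lam k := by
    intro k
    by_cases hk : k < 2 * n
    · rw [part, dif_pos hk]
    · rw [part, dif_neg hk, part, dif_neg (by omega)]
  have hD : shiftedDiagram mu = shiftedDiagram lam := by
    ext b
    rw [mem_shiftedDiagram_iff_part, mem_shiftedDiagram_iff_part, hpart]
  -- Padding can repeat the part `0`, so `mu` need not be strictly decreasing.
  have hstrict : StrictUntilZero mu := by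
    intro i j hij hj
    rw [hpart] at hj ⊢
    rw [hpart]
    have hjr : j < r := by
      by_contra hcon
      simp [part, hcon] at hj
    rw [part, part, dif_pos hjr, dif_pos (hij.trans hjr)]
    exact hlam hij
  have hprod : ∀ π : Equiv.Perm (Fin (2 * n)),
      MvPolynomial.coeff (∑ b, Finsupp.single b 1)
        (∏ t : Fin n, ∑ M ∈ boundedQSST ![mu (π (blockEquiv n (t, false))),
          mu (π (blockEquiv n (t, true)))] N, ∏ b, diagVar y (content b) (M b)) =
      ∑ σ ∈ diagPerms lam, ∏ t : Fin n,
        ∑ M ∈ boundedQSST ![part lam (π (blockEquiv n (t, false))),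
          part lam (π (blockEquiv n (t, true)))] N, ∏ b, y (σ (rowsEmb lam _ _ b)) (M b) := by
    intro π
    simp only [Finset.prod_univ_sum, MvPolynomial.coeff_sum]
    rw [Finset.sum_comm]
    refine Finset.sum_congr rfl fun f _ => ?_
    have := coeff_prod_diagVar_comp y (bijective_rowsEmb lam hn π) fun x => f x.1 x.2
    simpa only [Fintype.prod_sigma, content_rowsEmb] using this
  -- Both sides are coefficients of the product of all `X_b` in the Pfaffian formula with the
  -- weights `diagVar y`.
  calc ∑ σ ∈ diagPerms lam, ∑ M ∈ boundedQSST lam N, ∏ b, y (σ b) (M b)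
      = MvPolynomial.coeff (∑ b, Finsupp.single b 1)
          (∑ M ∈ boundedQSST lam N, ∏ b, diagVar y (content b) (M b)) := by
        rw [Finset.sum_comm, MvPolynomial.coeff_sum]
        exact Finset.sum_congr rfl fun M _ => (coeff_prod_diagVar y M).symm
    _ = ∑ π ∈ oneFactors n, ((Equiv.Perm.sign π : ℤ) : ℂ) *
          MvPolynomial.coeff (∑ b, Finsupp.single b 1)
          (∏ t : Fin n, ∑ M ∈ boundedQSST ![mu (π (blockEquiv n (t, false))),
            mu (π (blockEquiv n (t, true)))] N, ∏ b, diagVar y (content b) (M b)) := by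
        rw [sum_boundedQSST_congr hD, sum_boundedQSST_eq_pf hstrict, pf, MvPolynomial.coeff_sum]
        refine Finset.sum_congr rfl fun π _ => ?_
        rw [← MvPolynomial.coeff_C_mul]
        simp
    _ = _ := by
        simp only [hprod, pf, Finset.mul_sum]
        rw [Finset.sum_comm]

/-! ### Absolute convergence. -/

theorem summable_prod_apply {B α : Type*} [Fintype B] {f : α → ℝ} (hf : ∀ a, 0 ≤ f a)
    (hs : Summable f) : Summable fun M : B → α => ∏ b, f (M b) := by
  classical
  refine summable_of_sum_le (c := ∏ _b : B, ∑' a, f a)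
    (fun M => Finset.prod_nonneg fun b _ => hf _) fun u => ?_
  calc ∑ M ∈ u, ∏ b, f (M b)
      ≤ ∑ M ∈ Fintype.piFinset fun b => u.image fun M => M b, ∏ b, f (M b) := by
        refine Finset.sum_le_sum_of_subset_of_nonneg (fun M hM => ?_)
          fun M _ _ => Finset.prod_nonneg fun b _ => hf _
        exact Fintype.mem_piFinset.2 fun b => Finset.mem_image_of_mem (fun M => M b) hM
    _ = ∏ b, ∑ a ∈ u.image fun M => M b, f a := (Finset.prod_univ_sum _ _).symm
    _ ≤ ∏ _b : B, ∑' a, f a :=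
        Finset.prod_le_prod (fun b _ => Finset.sum_nonneg fun a _ => hf a)
          fun b _ => hs.sum_le_tsum _ fun a _ => hf a

theorem summable_markedLetter_rpow {t : ℝ} (ht : 1 < t) :
    Summable fun a : MarkedLetter => ((a.abs : ℕ) : ℝ) ^ (-t) := by
  have h1 : Summable fun k : ℕ+ => ((k : ℕ) : ℝ) ^ (-t) :=
    (Real.summable_nat_rpow.2 (by linarith)).comp_injective PNat.coe_injective
  have h2 : Summable fun _ : Bool => (1 : ℝ) := Summable.of_finite
  have h3 := h1.mul_of_nonneg h2 (fun k => by positivity) (fun _ => zero_le_one)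
  simp only [mul_one] at h3
  exact (Equiv.summable_iff (ofLex : MarkedLetter ≃ ℕ+ × Bool)).2 h3

/-- If the entry of `e b` is at least that of `b`, then exponents that are at least one, and
greater than one on the image of `e`, suffice for convergence. -/
theorem summable_prod_rpow {B : Type*} [Fintype B] {t : B → ℝ} (e : B → B) (h1 : ∀ b, 1 ≤ t b)
    (h2 : ∀ b, 1 < t (e b)) {P : Set (B → MarkedLetter)}
    (hP : ∀ M ∈ P, ∀ b, (M b).abs ≤ (M (e b)).abs) :
    Summable fun M : P => ∏ b, (((M.1 b).abs : ℕ) : ℝ) ^ (-t b) := by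
  classical
  -- `δ` is so small that the surplus at `e b` can supply `δ` to each of the at most `Fintype.card
  -- B` boxes that `e` sends there.
  obtain ⟨δ, hδ, hδt⟩ : ∃ δ : ℝ, 0 < δ ∧ ∀ b, Fintype.card B * δ ≤ t (e b) - 1 := by
    rcases isEmpty_or_nonempty B with hB | hB
    · exact ⟨1, one_pos, fun b => isEmptyElim b⟩
    · obtain ⟨b0, -, hb0⟩ := Finset.univ.exists_min_image (fun b => t (e b) - 1)
        Finset.univ_nonempty
      have hc : (0 : ℝ) < Fintype.card B := by exact_mod_cast Fintype.card_pos
      refine ⟨(t (e b0) - 1) / Fintype.card B, div_pos (by linarith [h2 b0]) hc, fun b => ?_⟩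
      rw [mul_div_cancel₀ _ hc.ne']
      exact hb0 b (Finset.mem_univ b)
  have hs := (summable_prod_apply (B := B) (fun a : MarkedLetter => by positivity)
    (summable_markedLetter_rpow (t := 1 + δ) (by linarith))).comp_injective
      (Subtype.val_injective (p := (· ∈ P)))
  refine Summable.of_nonneg_of_le (fun M => Finset.prod_nonneg fun b _ => by positivity)
    (fun M => ?_) hs
  have hpos : ∀ b, (1 : ℝ) ≤ ((M.1 b).abs : ℕ) := fun b => by exact_mod_cast (M.1 b).abs.pos
  have hpos' : ∀ b, (0 : ℝ) < ((M.1 b).abs : ℕ) := fun b => one_pos.trans_le (hpos b)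
  -- Charging the factor of `b` to the larger letter at `e b` gives a comparison with the exponent
  -- `1 + δ` at every box, where the letters are independent.
  have key : ∏ b, (((M.1 b).abs : ℕ) : ℝ) ^ δ ≤ ∏ b, (((M.1 b).abs : ℕ) : ℝ) ^ (t b - 1) := by
    calc ∏ b, (((M.1 b).abs : ℕ) : ℝ) ^ δ ≤ ∏ b, (((M.1 (e b)).abs : ℕ) : ℝ) ^ δ := by
          refine Finset.prod_le_prod (fun b _ => by positivity) fun b _ => ?_
          exact Real.rpow_le_rpow (hpos' b).le (by exact_mod_cast hP M.1 M.2 b) hδ.le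
      _ = ∏ c, ∏ _b with e _b = c, (((M.1 c).abs : ℕ) : ℝ) ^ δ := by
          rw [← Finset.prod_fiberwise Finset.univ e]
          refine Finset.prod_congr rfl fun c _ => Finset.prod_congr rfl fun b hb => ?_
          rw [(Finset.mem_filter.1 hb).2]
      _ ≤ ∏ c, (((M.1 c).abs : ℕ) : ℝ) ^ (t c - 1) := by
          refine Finset.prod_le_prod (fun c _ => by positivity) fun c _ => ?_
          rw [Finset.prod_const, ← Real.rpow_natCast, ← Real.rpow_mul (hpos' c).le]
          apply Real.rpow_le_rpow_of_exponent_le (hpos c)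
          rcases (Finset.univ.filter fun b => e b = c).eq_empty_or_nonempty with h | ⟨b, hb⟩
          · rw [h]
            simpa using h1 c
          · have h3 := hδt b
            rw [(Finset.mem_filter.1 hb).2] at h3
            have h4 : ((Finset.univ.filter fun b => e b = c).card : ℝ) ≤ Fintype.card B := by
              exact_mod_cast Finset.card_le_univ _
            nlinarith
  have hsplit : ∀ u : B → ℝ, ∏ b, (((M.1 b).abs : ℕ) : ℝ) ^ (-(1 + u b)) =
      (∏ b, (((M.1 b).abs : ℕ) : ℝ) ^ u b)⁻¹ * ∏ b, (((M.1 b).abs : ℕ) : ℝ) ^ (-1 : ℝ) := by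
    intro u
    rw [← Finset.prod_inv_distrib, ← Finset.prod_mul_distrib]
    refine Finset.prod_congr rfl fun b _ => ?_
    rw [← Real.rpow_neg (hpos' b).le, ← Real.rpow_add (hpos' b)]
    ring_nf
  have e1 := hsplit fun b => t b - 1
  have e2 := hsplit fun _ => δ
  simp only [add_sub_cancel] at e1
  simp only [Function.comp_apply]
  rw [e1, e2]
  gcongr

theorem norm_zetaQTerm {r : ℕ} {lam : Fin r → ℕ} (s : ShiftedTableau lam ℂ)
    (M : ShiftedTableau lam MarkedLetter) :
    ‖zetaQTerm s M‖ = ∏ b, (((M b).abs : ℕ) : ℝ) ^ (-(s b).re) := by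
  rw [zetaQTerm, norm_div, norm_one, norm_prod, one_div, ← Finset.prod_inv_distrib]
  refine Finset.prod_congr rfl fun b _ => ?_
  rw [Complex.norm_natCast_cpow_of_pos (M b).abs.pos, Real.rpow_neg (Nat.cast_nonneg _)]

/-- The last box of the row of `b`. -/
def rowEnd {r : ℕ} {lam : Fin r → ℕ} (b : Box lam) : Box lam :=
  ⟨(b.1.1, b.1.1 + (part lam b.1.1 - 1)), (add_mem_shiftedDiagram_iff lam _ _).2 (by
    have := (mem_shiftedDiagram_iff_part lam b.1).1 b.2
    omega)⟩

theorem part_pos_of_box {r : ℕ} {lam : Fin r → ℕ} (b : Box lam) : 0 < part lam b.1.1 := by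
  have := (mem_shiftedDiagram_iff_part lam b.1).1 b.2
  omega

theorem zetaQSummable_of_rowEnd {r : ℕ} {lam : Fin r → ℕ} {s : ShiftedTableau lam ℂ}
    (h1 : ∀ b, 1 ≤ (s b).re) (h2 : ∀ b, 1 < (s (rowEnd b)).re) : ZetaQSummable lam s := by
  refine Summable.of_norm ?_
  simp only [norm_zetaQTerm]
  refine summable_prod_rpow (t := fun b => (s b).re) rowEnd h1 h2 fun M hM b => ?_
  have := (mem_shiftedDiagram_iff_part lam b.1).1 b.2
  exact MarkedLetter.abs_le_abs (hM.row_weak _ _ rfl (by simp only [rowEnd]; omega))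

theorem content_rowEnd {r : ℕ} {lam : Fin r → ℕ} (b : Box lam) :
    content (rowEnd b) = (part lam b.1.1 : ℤ) - 1 := by
  have := part_pos_of_box b
  simp only [content, rowEnd]
  omega

theorem lt_of_part_pos {r : ℕ} {lam : Fin r → ℕ} {k : ℕ} (h : 0 < part lam k) : k < r := by
  by_contra hcon
  simp [part, hcon] at h

theorem one_le_re_of_mem_regionWQH {r : ℕ} {lam : Fin r → ℕ} {s : ShiftedTableau lam ℂ}
    (hs : s ∈ regionWQH lam) (b : Box lam) : 1 ≤ (s b).re := by
  by_cases hb : b ∈ rowEndDiagonals lam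
  · exact (hs.2 b hb).le
  · exact hs.1 b hb

theorem one_lt_re_of_mem_regionWQH {r : ℕ} {lam : Fin r → ℕ} {s : ShiftedTableau lam ℂ}
    (hs : s ∈ regionWQH lam) {b : Box lam} {k : ℕ} (hk : 0 < part lam k)
    (hb : content b = (part lam k : ℤ) - 1) : 1 < (s b).re := by
  refine hs.2 b ⟨⟨k, lt_of_part_pos hk⟩, ?_⟩
  rw [hb, ← part_of_fin lam]

theorem zetaQSummable_of_mem_regionWQH {r : ℕ} {lam : Fin r → ℕ} {s : ShiftedTableau lam ℂ}
    (hs : s ∈ regionWQH lam) : ZetaQSummable lam s :=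
  zetaQSummable_of_rowEnd (one_le_re_of_mem_regionWQH hs)
    fun b => one_lt_re_of_mem_regionWQH hs (part_pos_of_box b) (content_rowEnd b)

theorem zetaQSummable_twoRows {r : ℕ} {lam : Fin r → ℕ} {s : ShiftedTableau lam ℂ}
    (hs : s ∈ regionWQH lam) (i j : ℕ) :
    ZetaQSummable ![part lam i, part lam j] (twoRows lam s i j) := by
  rw [twoRows_eq_comp_rowsEmb]
  refine zetaQSummable_of_rowEnd (fun b => one_le_re_of_mem_regionWQH hs _) fun b => ?_
  have h1 := content_rowsEmb lam i j (rowEnd b)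
  rw [content_rowEnd] at h1
  have h2 := part_pos_of_box b
  rcases fst_cases b with hb | ⟨hb, -⟩
  · rw [hb] at h1 h2
    exact one_lt_re_of_mem_regionWQH hs (k := i) (by simpa [part] using h2)
      (by simpa [part] using h1)
  · rw [hb] at h1 h2
    exact one_lt_re_of_mem_regionWQH hs (k := j) (by simpa [part] using h2)
      (by simpa [part] using h1)

/-- The stricter condition is imposed on whole diagonals, and these are preserved by `σ`. -/
theorem comp_mem_regionWQH {r : ℕ} {lam : Fin r → ℕ} {s : ShiftedTableau lam ℂ}
    (hs : s ∈ regionWQH lam) {σ : Equiv.Perm (Box lam)} (hσ : σ ∈ diagPerms lam) :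
    s ∘ σ ∈ regionWQH lam := by
  have hσ' : ∀ b, content (σ b) = content b := (Finset.mem_filter.1 hσ).2
  have hmem : ∀ b, σ b ∈ rowEndDiagonals lam ↔ b ∈ rowEndDiagonals lam := fun b => by
    simp only [rowEndDiagonals, Set.mem_ofPred_eq, hσ']
  exact ⟨fun b hb => hs.1 _ (mt (hmem b).1 hb), fun b hb => hs.2 _ ((hmem b).2 hb)⟩

/-! ### Passage to infinitely many letters. -/

/-- The sets `boundedQSST lam N` increase and exhaust `QSST lam`. -/
theorem tendsto_sum_boundedQSST {r : ℕ} {lam : Fin r → ℕ} {s : ShiftedTableau lam ℂ}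
    (hs : ZetaQSummable lam s) :
    Filter.Tendsto (fun N => ∑ M ∈ boundedQSST lam N, zetaQTerm s M) Filter.atTop
      (nhds (zetaQ lam s)) := by
  classical
  have h1 : Filter.Tendsto (fun N => (boundedQSST lam N).subtype (· ∈ QSST lam)) Filter.atTop
      Filter.atTop := by
    apply Filter.tendsto_atTop_finset_of_monotone
    · intro N N' hN M hM
      simp only [Finset.mem_subtype, boundedQSST, Finset.mem_filter, Fintype.mem_piFinset,
        mem_letters] at hM ⊢
      exact ⟨fun b => (hM.1 b).trans hN, hM.2⟩
    · intro M
      refine ⟨∑ b, ((M.1 b).abs : ℕ), ?_⟩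
      simp only [Finset.mem_subtype, boundedQSST, Finset.mem_filter, Fintype.mem_piFinset,
        mem_letters]
      exact ⟨fun b => Finset.single_le_sum (f := fun b => ((M.1 b).abs : ℕ))
        (fun _ _ => Nat.zero_le _) (Finset.mem_univ b), M.2⟩
  refine (hs.hasSum.comp h1).congr fun N => ?_
  refine Finset.sum_subtype_of_mem (fun M => zetaQTerm s M) fun M hM => ?_
  exact (Finset.mem_filter.1 hM).2

theorem zetaQTerm_eq_prod {r : ℕ} {lam : Fin r → ℕ} (s : ShiftedTableau lam ℂ)
    (M : ShiftedTableau lam MarkedLetter) :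
    zetaQTerm s M = ∏ b, 1 / (((M b).abs : ℕ) : ℂ) ^ s b := by
  rw [zetaQTerm, Finset.prod_div_distrib, Finset.prod_const_one]

end SchurQZeta

theorem mainTheorem8 {r : ℕ} (lam : Fin r → ℕ) (hlam : StrictAnti lam)
    (s : SchurQZeta.ShiftedTableau lam ℂ) (hs : s ∈ SchurQZeta.regionWQH lam) :
    (∀ σ ∈ SchurQZeta.diagPerms lam, SchurQZeta.ZetaQSummable lam (s ∘ σ)) ∧
    (∀ σ ∈ SchurQZeta.diagPerms lam, ∀ i j : Fin (2 * ((r + 1) / 2)), i < j →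
      SchurQZeta.ZetaQSummable ![SchurQZeta.part lam i, SchurQZeta.part lam j]
        (SchurQZeta.twoRows lam (s ∘ σ) i j)) ∧
    ∑ σ ∈ SchurQZeta.diagPerms lam, SchurQZeta.zetaQ lam (s ∘ σ) =
      ∑ σ ∈ SchurQZeta.diagPerms lam,
        SchurQZeta.pfaffian (SchurQZeta.pfMatrix lam (s ∘ σ)) := by
  have hsum : ∀ σ ∈ SchurQZeta.diagPerms lam, SchurQZeta.ZetaQSummable lam (s ∘ σ) :=
    fun σ hσ => SchurQZeta.zetaQSummable_of_mem_regionWQH (SchurQZeta.comp_mem_regionWQH hs hσ)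
  have hsum2 : ∀ σ ∈ SchurQZeta.diagPerms lam, ∀ i j : ℕ,
      SchurQZeta.ZetaQSummable ![SchurQZeta.part lam i, SchurQZeta.part lam j]
        (SchurQZeta.twoRows lam (s ∘ σ) i j) :=
    fun σ hσ => SchurQZeta.zetaQSummable_twoRows (SchurQZeta.comp_mem_regionWQH hs hσ)
  refine ⟨hsum, fun σ hσ i j _ => hsum2 σ hσ i j, ?_⟩
  have hL := tendsto_finsetSum (SchurQZeta.diagPerms lam) fun σ hσ =>
    SchurQZeta.tendsto_sum_boundedQSST (hsum σ hσ)
  have hR : Filter.Tendsto (fun N => ∑ σ ∈ SchurQZeta.diagPerms lam,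
      SchurQZeta.pf fun i j : Fin (2 * ((r + 1) / 2)) =>
        ∑ M ∈ SchurQZeta.boundedQSST ![SchurQZeta.part lam i, SchurQZeta.part lam j] N,
          SchurQZeta.zetaQTerm (SchurQZeta.twoRows lam (s ∘ σ) i j) M) Filter.atTop
      (nhds (∑ σ ∈ SchurQZeta.diagPerms lam,
        SchurQZeta.pfaffian (SchurQZeta.pfMatrix lam (s ∘ σ)))) := by
    refine tendsto_finsetSum _ fun σ hσ => ?_
    have hpf : SchurQZeta.pfaffian (SchurQZeta.pfMatrix lam (s ∘ σ)) =
        SchurQZeta.pf fun i j : Fin (2 * ((r + 1) / 2)) =>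
          SchurQZeta.zetaQ ![SchurQZeta.part lam i, SchurQZeta.part lam j]
            (SchurQZeta.twoRows lam (s ∘ σ) i j) := by
      rw [SchurQZeta.pfaffian_eq_pf]
      refine SchurQZeta.pf_congr fun i j hij => ?_
      simp [SchurQZeta.pfMatrix, hij]
    rw [hpf]
    refine tendsto_finsetSum _ fun π _ => Filter.Tendsto.const_mul _ ?_
    exact tendsto_finsetProd _ fun t _ =>
      SchurQZeta.tendsto_sum_boundedQSST (hsum2 σ hσ _ _)
  -- For each `N` the two sequences agree, by the finite identity with the weights `1 / |a| ^ s b`.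
  refine tendsto_nhds_unique (hL.congr fun N => ?_) hR
  have := SchurQZeta.sum_diagPerms_boundedQSST hlam (n := (r + 1) / 2) (by omega) N
    fun b a => 1 / ((a.abs : ℕ) : ℂ) ^ s b
  simpa only [SchurQZeta.zetaQTerm_eq_prod, SchurQZeta.twoRows_eq_comp_rowsEmb,
    Function.comp_apply] using this
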